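/- **Setting.** Let $S$ be an oriented decorated surface (a compact oriented surface with boundary, with marked points on the boundary; boundary components without marked points are regarded as punctures) with an ideal triangulation $T$. That is, $S$ is obtained from finitely many oriented triangles by gluing certain pairs of sides by orientation-reversing maps. A glued pair of sides is an ideal arc, an unglued side is a boundary arc, and the vertices are the punctures and marked points. Let $\gamma$ be a simple closed curve in the interior of $S$ that is not contractible and not retractible to a puncture. Suppose $\gamma$ is in minimal position: it is transverse to the ideal arcs, disjoint from the boundary arcs, and no closed curve homotopic to it has fewer intersections with the ideal arcs. The intersection points of $\gamma$ with the ideal arcs are called junctures. They cut $\gamma$ into loop segments, each lying in a triangle. An inner arc segment is a part of an ideal arc between two adjacent junctures. The loop segments cut each triangle into small regions. A small region is narrow if its boundary contains an inner arc segment. The regional graph $\mathcal R$ has the narrow regions as vertices and one edge for each inner arc segment, joining the two narrow regions on its two sides (the edge crosses the inner arc segment). Every vertex has valence $1$, $2$ or $3$. A connected component of $\mathcal R$ is of type I if it contains a $1$-valent vertex and of type II otherwise. Vertices and edges have the type of their component. An arc-ordering on an ideal arc is a total ordering of its junctures. Suppose that each inner arc segment of an arc has an orientation and a positive difference number. These data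 yield an arc-ordering if a real function on the junctures of the arc, whose values at adjacent junctures differ by the difference number and decrease in the direction of the orientation, is injective; the arc-ordering is then the order of its values. An arc-ordering obtained from pairwise distinct difference numbers of the form $2^m$, $m\in\mathbb Z_{\ge 0}$, is called dyadic. Orientations and weights on the edges of $\mathcal R$ are transferred to the inner arc segments as follows: the difference number is the weight of the corresponding edge, and the orientation of the inner arc segment is obtained by turning right (with respect to the orientation of $S$) from the oriented edge at the crossing point. Arc-orderings are compatible at a triangle if, for each pair of the three sides of the triangle, the orderings on the two sides induce the same ordering on the set of loop segments that connect these two sides in this triangle. They are sane at a triangle if there are no three loop segments, one at each of the three corners, such that on each side the smaller-to-larger directions between the endpoints of the two of these segments meeting it are all clockwise or all counterclockwise around the triangle. **Proposition.** Suppose that an orientation and a weight are assigned to each edge of $\mathcal R$ such that the following conditions hold. 1. Each weight is $2^m$ for some positive integer $m$, and distinct edges have distinct weights. 2. At each $2$-valent vertex, one edge is incoming with weight $2^m$ for some $m$, and the other edge is outgoing with weight $2^{m+1}$. 3. At each $3$-valent vertex of type I, one edge is incoming with weight $2^m$ for some $m$, one edge is outgoing with weight $2^{m+1}$, and the remaining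 edge has either orientation and a weight $2^r$ with $r<m$. At each $3$-valent vertex of type II, at least one edge is incoming and at least one edge is outgoing. 4. The weight of every edge in a type I component is larger than the weight of every edge in a type II component. Then the orientations and difference numbers transferred to the inner arc segments yield a unique arc-ordering on every ideal arc of $T$. These arc-orderings are dyadic, and they are compatible and sane at every triangle of $T$. -/

import Mathlib

/-- An ideal triangulation of an oriented decorated surface, presented by its ideal triangles.
The surface is the union of the triangles `t : Tri`, each with vertices `0, 1, 2` in
counterclockwise order with respect to the orientation of the surface; the side `(t, i)` runs from
vertex `i` to vertex `i + 1`, so that the interior of `t` is on its left.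
A side `s` with `glue s ≠ s` is glued to the side `glue s` by an orientation-reversing map, and the
two sides together are one ideal arc (the two sides may belong to the same triangle, which is then
self-folded). A side `s` with `glue s = s` is a boundary arc.
The vertices of the triangles are the punctures and the marked points; they are not points of the
surface on which curves live. -/
structure IdealTriangulation (Tri : Type*) where
  glue : Tri × Fin 3 → Tri × Fin 3
  glue_glue : ∀ s, glue (glue s) = s

namespace IdealTriangulation

variable {Tri : Type*} (T : IdealTriangulation Tri)

/-! ### Closed curves transverse to the arcs, up to homotopy

A closed curve that is transverse to the ideal arcs is recorded, up to homotopies that do not change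
the way it meets the arcs, by the cyclic sequence of its crossings: the entry `s = (t, i)` means
that the curve leaves the triangle `t` through the side `s` and enters the triangle of `glue s`. -/

/-- The cyclic sequence `w` of sides is the crossing sequence of a closed curve. -/
def IsClosedPath (w : Cycle (Tri × Fin 3)) : Prop :=
  (∀ s ∈ w, T.glue s ≠ s) ∧ w.Chain (fun s s' => (T.glue s).1 = s'.1)

/-- The elementary homotopy: a curve that crosses an arc and at once crosses it back is pushed off
this arc. -/
inductive ElementaryHomotopy : Cycle (Tri × Fin 3) → Cycle (Tri × Fin 3) → Prop
  | backtrack (s : Tri × Fin 3) (w : List (Tri × Fin 3))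
      (h : T.IsClosedPath ((s :: T.glue s :: w : List (Tri × Fin 3)) : Cycle (Tri × Fin 3))) :
      ElementaryHomotopy ((s :: T.glue s :: w : List (Tri × Fin 3)) : Cycle (Tri × Fin 3))
        (w : Cycle (Tri × Fin 3))

/-- Free homotopy of closed curves. -/
def Homotopic : Cycle (Tri × Fin 3) → Cycle (Tri × Fin 3) → Prop :=
  Relation.EqvGen T.ElementaryHomotopy

/-- The preceding side `(t, i - 1)` of the same triangle; it ends at the vertex `i` at which the
side `(t, i)` starts. -/
def prevSide (s : Tri × Fin 3) : Tri × Fin 3 := (s.1, s.2 - 1)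

/-- Identify a side with the corner at its starting vertex. `nextCorner s` is the next
corner counterclockwise around the same vertex of the triangulation. -/
def nextCorner (s : Tri × Fin 3) : Tri × Fin 3 := T.glue (prevSide s)

/-- The crossing sequence of `k` consecutive steps counterclockwise around a vertex. -/
def aroundVertex (s : Tri × Fin 3) (k : ℕ) : List (Tri × Fin 3) :=
  (List.range k).map fun j => prevSide (T.nextCorner^[j] s)

/-- `w` is the crossing sequence of a closed curve going (one or several times) around a puncture,
i.e. around a vertex at which no boundary arc ends. -/
def IsPunctureLoop (w : Cycle (Tri × Fin 3)) : Prop :=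
  ∃ s k, 0 < k ∧ T.nextCorner^[k] s = s ∧
    (∀ j, T.glue (prevSide (T.nextCorner^[j] s)) ≠ prevSide (T.nextCorner^[j] s)) ∧
    w = (T.aroundVertex s k : Cycle (Tri × Fin 3))

/-- The points in which a curve meets the sides of the triangles, if it meets the side `s` in
`count s` points: `(s, p)` is the `p`-th point (from `0`) along the side `s`. -/
abbrev Point (count : Tri × Fin 3 → ℕ) : Type _ :=
  {x : (Tri × Fin 3) × ℕ // x.2 < count x.1}

/-- `x` comes before `y` on the boundary of their triangle, which is run through counterclockwise
from vertex `0`. -/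
def PointLT {count : Tri × Fin 3 → ℕ} (x y : Point count) : Prop :=
  x.1.1.2 < y.1.1.2 ∨ (x.1.1.2 = y.1.1.2 ∧ x.1.2 < y.1.2)

/-- A simple closed curve in the surface that is transverse to the triangulation and meets at least
one ideal arc, up to isotopies preserving each arc. (A closed curve meeting no arc lies inside
a triangle and is contractible.) Each juncture appears as two points `x` and `across x`, one on each
of the two sides forming its ideal arc. The loop segments are the pairs `{x, partner x}`: they are
curves inside a triangle with endpoints on its boundary, and they are pairwise disjoint, i.e.
no two of them have interlaced endpoints. -/
structure SimpleLoop where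
  count : Tri × Fin 3 → ℕ
  count_glue : ∀ s, count (T.glue s) = count s
  count_boundary : ∀ s, T.glue s = s → count s = 0
  partner : Point count → Point count
  partner_partner : ∀ x, partner (partner x) = x
  partner_ne : ∀ x, partner x ≠ x
  partner_triangle : ∀ x, (partner x).1.1.1 = x.1.1.1
  noncrossing : ∀ x y : Point count, x.1.1.1 = y.1.1.1 →
    ¬ (PointLT x y ∧ PointLT y (partner x) ∧ PointLT (partner x) (partner y))
  nonempty : Nonempty (Point count)
  /-- The curve has one component: all points are linked by following the curve. -/
  connected : ∀ x y : Point count, Relation.EqvGen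
    (fun a b => b = partner a ∨
      b.1 = (T.glue a.1.1, count a.1.1 - 1 - a.1.2)) x y

namespace SimpleLoop

variable {T} (γ : T.SimpleLoop)

/-- The same juncture, seen from the other side of its arc. -/
def across (x : Point γ.count) : Point γ.count :=
  ⟨(T.glue x.1.1, γ.count x.1.1 - 1 - x.1.2), by
    have h1 := x.2
    have h2 := γ.count_glue x.1.1
    dsimp only
    omega⟩

/-- Leave the triangle at `x`, and follow the curve to the point where it leaves the next one. -/
def next (x : Point γ.count) : Point γ.count := γ.partner (γ.across x)

/-- The crossing sequence of the curve, followed once around, starting by leaving the triangle at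
the juncture `x`. Starting from `x` or from `across x` gives the two directions of the curve. -/
noncomputable def crossings (x : Point γ.count) : Cycle (Tri × Fin 3) :=
  (((List.range (Function.minimalPeriod γ.next x)).map fun j => (γ.next^[j] x).1.1 :
    List (Tri × Fin 3)) : Cycle (Tri × Fin 3))

/-- The curve can be retracted to a point. -/
def Contractible : Prop :=
  ∃ x, T.Homotopic (γ.crossings x) Cycle.nil

/-- The curve can be retracted to a puncture. -/
def Peripheral : Prop :=
  ∃ x w, T.IsPunctureLoop w ∧ T.Homotopic (γ.crossings x) w

/-- No closed curve homotopic to the given one has fewer intersections with the ideal arcs. -/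
def MinimalPosition : Prop :=
  ∀ x w, T.Homotopic (γ.crossings x) w → (γ.crossings x).length ≤ w.length

/-! ### Narrow regions and the regional graph -/

/-- The arc segments as seen from a side: `(s, k)` with `0 ≤ k ≤ count s` is the part of the side
`s` between its points `k - 1` and `k`, where the first and the last one end at a vertex. -/
abbrev Piece : Type _ := {a : (Tri × Fin 3) × ℕ // a.2 ≤ γ.count a.1}

/-- The segment `a` comes before the point `x` on the boundary of their triangle. -/
def PieceBefore (a : γ.Piece) (x : Point γ.count) : Prop :=
  a.1.1.2 < x.1.1.2 ∨ (a.1.1.2 = x.1.1.2 ∧ a.1.2 ≤ x.1.2)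

/-- The endpoints `x, partner x` of a loop segment cut the boundary of the triangle into two parts:
this says that `a` is on the part that contains vertex `0`. -/
def OnOuterPart (a : γ.Piece) (x : Point γ.count) : Prop :=
  γ.PieceBefore a x ↔ γ.PieceBefore a (γ.partner x)

/-- Two segments on the boundary of one triangle border the same small region if and only if no loop
segment of this triangle separates them. -/
def regionSetoid : Setoid γ.Piece where
  r a b := a.1.1.1 = b.1.1.1 ∧ ∀ x : Point γ.count, x.1.1.1 = a.1.1.1 →
    (γ.OnOuterPart a x ↔ γ.OnOuterPart b x)
  iseqv :=
    { refl := fun _ => ⟨rfl, fun _ _ => Iff.rfl⟩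
      symm := fun h => ⟨h.1.symm, fun x hx => (h.2 x (hx.trans h.1.symm)).symm⟩
      trans := fun h h' => ⟨h.1.trans h'.1,
        fun x hx => (h.2 x hx).trans (h'.2 x (hx.trans h.1))⟩ }

/-- The small regions into which the loop segments divide the triangles. Since the loop segments of
a triangle are disjoint, a small region is determined by the segments on its boundary. -/
def SmallRegion : Type _ := Quotient γ.regionSetoid

/-- The inner arc segments as seen from a side, that is, the ends of the narrow regions.
Each inner arc segment is a pair `{a, a.flip}`. They are also the half-edges of the
regional graph: the edge crossing the inner arc segment `{a, flip a}` has the two halves `a` and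
`flip a`. -/
abbrev End : Type _ := {a : (Tri × Fin 3) × ℕ // 0 < a.2 ∧ a.2 < γ.count a.1}

/-- The same inner arc segment, seen from the other side of its arc. -/
def flip (a : γ.End) : γ.End :=
  ⟨(T.glue a.1.1, γ.count a.1.1 - a.1.2), by
    have h1 := a.2
    have h2 := γ.count_glue a.1.1
    dsimp only
    omega⟩

/-- The juncture at which the inner arc segment begins, counterclockwise along the side. -/
def startPoint (a : γ.End) : Point γ.count :=
  ⟨(a.1.1, a.1.2 - 1), lt_of_le_of_lt (Nat.sub_le _ _) a.2.2⟩

/-- The juncture at which the inner arc segment stops, counterclockwise along the side. -/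
def endPoint (a : γ.End) : Point γ.count := ⟨a.1, a.2.2⟩

/-- The small region that has `a` on its boundary. -/
def regionOf (a : γ.End) : γ.SmallRegion :=
  Quotient.mk γ.regionSetoid ⟨a.1, a.2.2.le⟩

/-- The narrow regions, i.e. the vertices of the regional graph. -/
def NarrowRegion : Type _ := {r : γ.SmallRegion // ∃ a, γ.regionOf a = r}

/-- The vertex of the regional graph to which the half-edge `a` is attached. -/
def vertexOf (a : γ.End) : γ.NarrowRegion := ⟨γ.regionOf a, a, rfl⟩

/-- The half-edges attached to a vertex, i.e. the ends of the corresponding narrow region. -/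
def endsAt (v : γ.NarrowRegion) : Set γ.End := {a | γ.vertexOf a = v}

/-- The number of edges of the regional graph attached to a vertex. -/
noncomputable def valence (v : γ.NarrowRegion) : ℕ := (γ.endsAt v).ncard

/-- Adjacency in the regional graph: two distinct narrow regions are joined if they have an inner
arc segment in common. -/
def regionalGraph : SimpleGraph γ.NarrowRegion :=
  SimpleGraph.fromRel fun u v => ∃ a, γ.vertexOf a = u ∧ γ.vertexOf (γ.flip a) = v

/-- A connected component of the regional graph is of type I if it contains a 1-valent vertex,
and of type II otherwise. -/
def IsTypeIComponent (C : γ.regionalGraph.ConnectedComponent) : Prop :=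
  ∃ v, γ.regionalGraph.connectedComponentMk v = C ∧ γ.valence v = 1

/-- A vertex is of type I if its component is, and of type II otherwise. -/
def IsTypeI (v : γ.NarrowRegion) : Prop :=
  γ.IsTypeIComponent (γ.regionalGraph.connectedComponentMk v)

/-! ### Data on the edges of the regional graph and on the inner arc segments -/

/-- An orientation and a weight on every edge of the regional graph: `incoming a` says that
the edge with half-edge `a` points towards `vertexOf a` (otherwise it points away from it, towards
`vertexOf (flip a)`). -/
structure EdgeData where
  incoming : γ.End → Prop
  weight : γ.End → ℝ
  incoming_flip : ∀ a, incoming (γ.flip a) ↔ ¬ incoming a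
  weight_flip : ∀ a, weight (γ.flip a) = weight a

/-- An orientation and a number on every inner arc segment: `forward a` says that the segment is
oriented from `startPoint a` to `endPoint a`, i.e. counterclockwise around the triangle from which
it is seen. -/
structure ArcData where
  forward : γ.End → Prop
  number : γ.End → ℝ
  forward_flip : ∀ a, forward (γ.flip a) ↔ ¬ forward a
  number_flip : ∀ a, number (γ.flip a) = number a

/-- An arc-ordering on every ideal arc: a strict total order on the junctures of each
arc. The order is recorded on the points of each side, and it is the same order when the arc is seen
from its other side. -/
@[ext]
structure ArcOrdering where
  lt : Point γ.count → Point γ.count → Prop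
  same_side : ∀ x y, lt x y → x.1.1 = y.1.1
  irrefl : ∀ x, ¬ lt x x
  trans : ∀ x y z, lt x y → lt y z → lt x z
  total : ∀ x y, x.1.1 = y.1.1 → x ≠ y → lt x y ∨ lt y x
  lt_across : ∀ x y, lt (γ.across x) (γ.across y) ↔ lt x y

variable {γ}

/-- The data transferred to the inner arc segments: the numbers are the same, and
the orientation of an edge turns to the right where it crosses the inner arc segment. An edge that
enters a triangle through one of its sides turns, in this way, into the counterclockwise direction
along this side, since the triangle is on the left of the side. -/
def EdgeData.transfer (D : γ.EdgeData) : γ.ArcData where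
  forward := D.incoming
  number := D.weight
  forward_flip := D.incoming_flip
  number_flip := D.weight_flip

/-- A function on the junctures whose differences at adjacent junctures are the given numbers, each
inner arc segment being oriented towards the juncture of smaller value. -/
def ArcData.IsHeight (A : γ.ArcData) (π : Point γ.count → ℝ) : Prop :=
  (∀ x, π (γ.across x) = π x) ∧
  ∀ a, (A.forward a → π (γ.startPoint a) - π (γ.endPoint a) = A.number a) ∧
    (¬ A.forward a → π (γ.endPoint a) - π (γ.startPoint a) = A.number a)

/-- The data yield the arc-orderings `O`: on each arc, `O` is the order of the values of
a function with the given differences. -/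
def ArcData.Yields (A : γ.ArcData) (O : γ.ArcOrdering) : Prop :=
  ∃ π, A.IsHeight π ∧ ∀ x y, x.1.1 = y.1.1 → (O.lt x y ↔ π x < π y)

/-- On each arc, the numbers on the inner arc segments are distinct powers of two. -/
def ArcData.IsDyadic (A : γ.ArcData) : Prop :=
  (∀ a, ∃ m : ℕ, A.number a = 2 ^ m) ∧
  ∀ a b : γ.End, a.1.1 = b.1.1 → A.number a = A.number b → a = b

/-- All arc-orderings are dyadic. -/
def ArcOrdering.IsDyadic (O : γ.ArcOrdering) : Prop :=
  ∃ A : γ.ArcData, A.IsDyadic ∧ A.Yields O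

/-- For each pair of sides of the triangle `t`, the orderings on the two sides induce the same
ordering on the loop segments connecting these two sides. -/
def ArcOrdering.CompatibleAt (O : γ.ArcOrdering) (t : Tri) : Prop :=
  ∀ i j : Fin 3, i ≠ j → ∀ x y : Point γ.count, x.1.1 = (t, i) → y.1.1 = (t, i) →
    (γ.partner x).1.1 = (t, j) → (γ.partner y).1.1 = (t, j) →
    (O.lt x y ↔ O.lt (γ.partner x) (γ.partner y))

/-- Three loop segments `{x i, partner (x i)}`, the `i`-th one at the corner of `t` between the sides
`i` and `i + 1`, form an insane triple: the orders of their endpoints, `partner (x i)` and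
`x (i + 1)` on side `i + 1`, are all counterclockwise or all clockwise. -/
def ArcOrdering.InsaneTriple (O : γ.ArcOrdering) (t : Tri) (x : Fin 3 → Point γ.count) : Prop :=
  (∀ i, (x i).1.1 = (t, i) ∧ (γ.partner (x i)).1.1 = (t, i + 1)) ∧
  ((∀ i, O.lt (γ.partner (x i)) (x (i + 1))) ∨ (∀ i, O.lt (x (i + 1)) (γ.partner (x i))))

/-- There is no insane triple in the triangle `t`. -/
def ArcOrdering.SaneAt (O : γ.ArcOrdering) (t : Tri) : Prop :=
  ∀ x, ¬ O.InsaneTriple t x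

/-- Every weight is `2 ^ m` with a positive integer `m`, and distinct edges have distinct
weights. -/
def EdgeData.DistinctDyadicWeights (D : γ.EdgeData) : Prop :=
  (∀ a, ∃ m : ℕ, 0 < m ∧ D.weight a = 2 ^ m) ∧
  ∀ a b, D.weight a = D.weight b → b = a ∨ b = γ.flip a

/-- At a 2-valent vertex, one edge is incoming with weight `2 ^ m` and the other one is outgoing with
weight `2 ^ (m + 1)`. -/
def EdgeData.FlowAtTwoValent (D : γ.EdgeData) : Prop :=
  ∀ v, γ.valence v = 2 → ∃ a b, ∃ m : ℕ, γ.endsAt v = {a, b} ∧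
    D.incoming a ∧ D.weight a = 2 ^ m ∧ ¬ D.incoming b ∧ D.weight b = 2 ^ (m + 1)

/-- At a 3-valent vertex of type I, one edge is incoming with weight `2 ^ m`, one is outgoing with
weight `2 ^ (m + 1)`, and the remaining one has either orientation and weight `2 ^ r`, `r < m`. -/
def EdgeData.FlowAtThreeValentTypeI (D : γ.EdgeData) : Prop :=
  ∀ v, γ.valence v = 3 → γ.IsTypeI v → ∃ a b c, ∃ m r : ℕ, γ.endsAt v = {a, b, c} ∧
    D.incoming a ∧ D.weight a = 2 ^ m ∧ ¬ D.incoming b ∧ D.weight b = 2 ^ (m + 1) ∧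
    D.weight c = 2 ^ r ∧ r < m

/-- At a 3-valent vertex of type II, there are an incoming edge and an outgoing edge. -/
def EdgeData.FlowAtThreeValentTypeII (D : γ.EdgeData) : Prop :=
  ∀ v, γ.valence v = 3 → ¬ γ.IsTypeI v →
    (∃ a ∈ γ.endsAt v, D.incoming a) ∧ (∃ a ∈ γ.endsAt v, ¬ D.incoming a)

/-- The weights on type I components are larger than the weights on type II components. -/
def EdgeData.TypeIAboveTypeII (D : γ.EdgeData) : Prop :=
  ∀ a b, γ.IsTypeI (γ.vertexOf a) → ¬ γ.IsTypeI (γ.vertexOf b) → D.weight b < D.weight a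

end SimpleLoop

end IdealTriangulation

/-!
The proof works in normal coordinates. In minimal position no loop segment has both ends on one side
of a triangle, since an elementary homotopy would remove it (`MinimalPosition.partner_side_ne`). So
each triangle `t` has, for every corner `i`, a number `c t i` of parallel loop segments cutting off
this corner, and no other segments (`IsCornerCount`). The narrow regions are read off from these
numbers: the regions between adjacent parallel segments have two ends, and the central region has
one end on each side both of whose corners are cut off (`vertexOf_eq_iff_of_next`, `end_cases`).

A function with the given differences exists on every arc, and the difference of its values at two
junctures is a signed sum of distinct powers of two, whose sign is that of the largest term: the
*dominant* inner arc segment between the two junctures decides (`height_lt`). This gives existence,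
uniqueness and dyadicity of the arc-orderings.

Compatibility: passing through a 2-valent region doubles or halves the weight, and since the weights
are distinct, the end opposite to the dominant end between two parallel segments is dominant
on its own side (`height_lt_partner_iff`).

Sanity: let three loop segments, one at each corner, form an insane triple. The part of the triangle
between them is a union of narrow regions, and the dominant ends on its three sides are all incoming
or all outgoing. Consider the region with the end `M` of largest weight (`not_all_dominant_iff`).
* If this region is 2-valent, or 3-valent of type I, then `M` is outgoing with weight `2 ^ (m + 1)`
  and there is an incoming end of weight `2 ^ m` on another side. On that side an outgoing end has
  to dominate, but no weight is left for it.
* If it is 3-valent of type II, then all regions in this part are of type II, as the weights of type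
  I are larger. Two narrow regions on the two sides of a loop segment are never both of type II
  (`not_betweenTypeII`): the regions on either side of the curve could be followed all along
  the curve, but the first juncture on an arc is next to a vertex. So the part consists
  of the central region alone, whose three ends would be all incoming or all outgoing.
-/

namespace IdealTriangulation

namespace SimpleLoop

variable {Tri : Type*} {T : IdealTriangulation Tri} {γ : T.SimpleLoop}

/-! ### Curves in minimal position do not backtrack -/

lemma glue_ne_of_point (x : Point γ.count) : T.glue x.1.1 ≠ x.1.1 := fun h => by
  have h1 := γ.count_boundary _ h
  have h2 := x.2
  omega

lemma across_across (x : Point γ.count) : γ.across (γ.across x) = x := by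
  have h1 := x.2
  have h2 := γ.count_glue x.1.1
  refine Subtype.ext (Prod.ext (T.glue_glue _) ?_)
  simp only [across]
  omega

lemma partner_injective : Function.Injective γ.partner :=
  (show Function.Involutive γ.partner from γ.partner_partner).injective

lemma across_injective : Function.Injective γ.across :=
  (show Function.Involutive γ.across from across_across).injective

lemma next_injective : Function.Injective γ.next :=
  fun _ _ h => across_injective (partner_injective h)

instance [Finite Tri] : Finite (Point γ.count) := by
  refine Finite.of_injective
    (β := Σ s : Tri × Fin 3, Fin (γ.count s)) (fun x => ⟨x.1.1, x.1.2, x.2⟩) ?_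
  rintro ⟨⟨s, p⟩, hp⟩ ⟨⟨s', p'⟩, hp'⟩ h
  simp only [Sigma.mk.injEq] at h
  obtain ⟨rfl, h⟩ := h
  simpa using h

lemma isClosedPath_crossings (x : Point γ.count)
    (hpos : 0 < Function.minimalPeriod γ.next x) : T.IsClosedPath (γ.crossings x) := by
  obtain ⟨n, hn⟩ := Nat.exists_eq_succ_of_ne_zero hpos.ne'
  have hstep : ∀ y : Point γ.count, (T.glue y.1.1).1 = (γ.next y).1.1.1 := fun y =>
    (γ.partner_triangle (γ.across y)).symm
  constructor
  · intro s hs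
    simp only [crossings, Cycle.mem_coe_iff, List.mem_map] at hs
    obtain ⟨j, -, rfl⟩ := hs
    exact glue_ne_of_point _
  · have : γ.crossings x = ((List.range n.succ : List ℕ) : Cycle ℕ).map
        (fun j => (γ.next^[j] x).1.1) := by
      simp only [crossings, hn, Cycle.map_coe]
    rw [this, Cycle.chain_map, Cycle.chain_range_succ]
    have hs : ∀ j, (T.glue (γ.next^[j] x).1.1).1 = (γ.next^[j + 1] x).1.1.1 := fun j => by
      rw [Function.iterate_succ_apply']
      exact hstep _
    refine ⟨?_, fun m _ => hs m⟩
    have h := hs n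
    have hper : γ.next^[n + 1] x = x := by
      have := Function.isPeriodicPt_minimalPeriod γ.next x
      rwa [hn] at this
    rw [hper] at h
    simpa using h

/-- A loop segment with both ends on one side would be removed by an elementary homotopy. -/
lemma MinimalPosition.partner_side_ne [Finite Tri] (hmin : γ.MinimalPosition)
    (z : Point γ.count) : (γ.partner z).1.1 ≠ z.1.1 := by
  intro hz
  set x := γ.across z with hx
  have hnext : γ.next x = γ.partner z := by rw [next, hx, across_across]
  have hxs : x.1.1 = T.glue z.1.1 := rfl
  have hpos : 0 < Function.minimalPeriod γ.next x :=
    Function.minimalPeriod_pos_of_mem_periodicPts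
      (next_injective.mem_periodicPts x)
  have hne : Function.minimalPeriod γ.next x ≠ 1 := by
    intro h1
    have : γ.next x = x := Function.minimalPeriod_eq_one_iff_isFixedPt.1 h1
    rw [hnext] at this
    rw [this] at hz
    exact glue_ne_of_point z (hxs ▸ hz)
  obtain ⟨n, hn⟩ : ∃ n, Function.minimalPeriod γ.next x = n + 2 :=
    ⟨Function.minimalPeriod γ.next x - 2, by omega⟩
  obtain ⟨w, hw, hwl⟩ : ∃ w : List (Tri × Fin 3), γ.crossings x =
      ((x.1.1 :: T.glue x.1.1 :: w : List (Tri × Fin 3)) : Cycle (Tri × Fin 3)) ∧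
      w.length = n := by
    refine ⟨(List.range n).map fun j => (γ.next^[j + 2] x).1.1, ?_, by simp⟩
    have h1 : (γ.next x).1.1 = T.glue x.1.1 := by rw [hnext, hz, hxs, T.glue_glue]
    rw [crossings, hn, List.range_succ_eq_map, List.range_succ_eq_map]
    simp [h1, Function.comp_def]
  have hcl := isClosedPath_crossings x hpos
  have hlen := hmin x (w : Cycle (Tri × Fin 3)) (Relation.EqvGen.rel _ _ (by
    rw [hw] at hcl ⊢
    exact ElementaryHomotopy.backtrack _ _ hcl))
  rw [hw] at hlen
  simp at hlen

/-! ### The loop segments of a triangle -/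

/-- No loop segment has both ends on one side of a triangle. -/
def NoBacktrack (γ : T.SimpleLoop) : Prop :=
  ∀ x : Point γ.count, (γ.partner x).1.1 ≠ x.1.1

lemma NoBacktrack.side_ne (h : γ.NoBacktrack) (x : Point γ.count) :
    (γ.partner x).1.1.2 ≠ x.1.1.2 := fun h' =>
  h x (Prod.ext (γ.partner_triangle x) h')

lemma fin3_cases {i j : Fin 3} (h : j ≠ i) : j = i + 1 ∨ j = i + 2 := by
  revert h; revert i j; decide

/-- If a loop segment starting at `x` cuts off the corner at the end of its side, then the loop
segments starting between `x` and this corner are parallel to it. -/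
lemma NoBacktrack.partner_of_lt (h : γ.NoBacktrack) {x y : Point γ.count} (hs : x.1.1 = y.1.1)
    (hlt : x.1.2 < y.1.2) (hx : (γ.partner x).1.1.2 = x.1.1.2 + 1) :
    (γ.partner y).1.1.2 = y.1.1.2 + 1 ∧ (γ.partner y).1.2 < (γ.partner x).1.2 := by
  have hne : (γ.partner y).1 ≠ (γ.partner x).1 := fun h' => by
    have := partner_injective (Subtype.ext h')
    rw [this] at hlt
    omega
  have hy := h.side_ne y
  have ht : x.1.1.1 = y.1.1.1 := by rw [hs]
  have hpx := γ.partner_triangle x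
  have hpy := γ.partner_triangle y
  have n1 := γ.noncrossing x y ht
  have n2 := γ.noncrossing (γ.partner y) x (hpy.trans ht.symm)
  have n3 := γ.noncrossing (γ.partner x) (γ.partner y) (by rw [hpx, hpy, ht])
  simp only [γ.partner_partner, PointLT] at n1 n2 n3
  have hs2 : x.1.1.2 = y.1.1.2 := by rw [hs]
  have hne' : (γ.partner y).1.1.2 = (γ.partner x).1.1.2 →
      (γ.partner y).1.2 ≠ (γ.partner x).1.2 := fun h1 h2 => by
    exact hne (Prod.ext (Prod.ext (by rw [hpx, hpy, ht]) h1) h2)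
  rw [hs2] at hx n1 n2 n3
  generalize (γ.partner y).1.1.2 = j at *
  generalize (γ.partner x).1.1.2 = l at *
  generalize y.1.1.2 = i at *
  subst hx
  fin_cases i <;> fin_cases j <;> simp_all [-not_and, -not_or] <;> omega

lemma NoBacktrack.partner_next_or (h : γ.NoBacktrack) (x : Point γ.count) :
    (γ.partner x).1.1.2 = x.1.1.2 + 1 ∨ (γ.partner x).1.1.2 = x.1.1.2 + 2 :=
  fin3_cases (h.side_ne x)

lemma fin3_add_one_add_two (i : Fin 3) : i + 1 + 2 = i := by revert i; decide

lemma fin3_add_two_add_one (i : Fin 3) : i + 2 + 1 = i := by revert i; decide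

lemma fin3_add_two_add_two (i : Fin 3) : i + 2 + 2 = i + 1 := by revert i; decide

lemma fin3_add_one_add_one (i : Fin 3) : i + 1 + 1 = i + 2 := by revert i; decide

lemma fin3_add_one_add_one_ne (i : Fin 3) : i + 1 + 1 ≠ i := by revert i; decide

lemma exists_point {s : Tri × Fin 3} {p : ℕ} (h : p < γ.count s) :
    ∃ x : Point γ.count, x.1.1 = s ∧ x.1.2 = p := ⟨⟨(s, p), h⟩, rfl, rfl⟩

lemma partner_eq_of_eq {x y : Point γ.count} (h : γ.partner x = y) : γ.partner y = x := by
  rw [← h, γ.partner_partner]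

/-- The loop segments at a corner join the points of its two sides in the order of their distance
from the corner. -/
lemma NoBacktrack.partner_add (h : γ.NoBacktrack) (x : Point γ.count)
    (hx : (γ.partner x).1.1.2 = x.1.1.2 + 1) :
    (γ.partner x).1.2 + x.1.2 + 1 = γ.count x.1.1 := by
  -- The `q` points between `x` and the corner are joined to points of the next side that are nearer
  -- to the corner than `partner x`.
  have h1 : ∀ q, ∀ x : Point γ.count, (γ.partner x).1.1.2 = x.1.1.2 + 1 →
      x.1.2 + q + 1 = γ.count x.1.1 → q ≤ (γ.partner x).1.2 := by
    intro q
    induction q with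
    | zero => intros; omega
    | succ q ih =>
      intro x hx hq
      let y : Point γ.count := ⟨(x.1.1, x.1.2 + 1), by simp only; omega⟩
      obtain ⟨hy, hlt⟩ := h.partner_of_lt (x := x) (y := y) rfl (Nat.lt_succ_self _) hx
      have := ih y hy (by simp only [y]; omega)
      omega
  -- Conversely, the `q` points between the corner and `partner x` are joined to points beyond `x`.
  have h2 : ∀ q, ∀ x : Point γ.count, (γ.partner x).1.1.2 = x.1.1.2 + 1 →
      (γ.partner x).1.2 = q → x.1.2 + q < γ.count x.1.1 := by
    intro q
    induction q with
    | zero => intro x _ _; exact x.2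
    | succ q ih =>
      intro x hx hq
      have hlt := (γ.partner x).2
      let z : Point γ.count := ⟨((γ.partner x).1.1, q), by simp only; omega⟩
      have hzx : z.1.2 < (γ.partner x).1.2 := by simp only [z]; omega
      have hz : (γ.partner z).1.1.2 = z.1.1.2 + 2 := by
        rcases h.partner_next_or z with hz | hz
        · have := (h.partner_of_lt (x := z) (y := γ.partner x) rfl hzx hz).1
          rw [γ.partner_partner, hx] at this
          exact absurd this.symm (fin3_add_one_add_one_ne _)
        · exact hz
      have hside : (γ.partner z).1.1.2 = x.1.1.2 := by
        rw [hz, show z.1.1.2 = x.1.1.2 + 1 from hx]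
        exact fin3_add_one_add_two _
      have htri : (γ.partner z).1.1.1 = x.1.1.1 := by
        rw [γ.partner_triangle]; exact γ.partner_triangle x
      have hs : (γ.partner z).1.1 = x.1.1 := Prod.ext htri hside
      have hz' : (γ.partner (γ.partner z)).1.1.2 = (γ.partner z).1.1.2 + 1 := by
        rw [γ.partner_partner, hside]; exact hx
      have hi := ih _ hz' (by rw [γ.partner_partner])
      rw [hs] at hi
      rcases lt_trichotomy (γ.partner z).1.2 x.1.2 with hl | he | hg
      · have := (h.partner_of_lt hs hl hz').2
        rw [γ.partner_partner] at this
        omega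
      · have : γ.partner z = x := Subtype.ext (Prod.ext hs he)
        rw [← partner_eq_of_eq this] at hzx
        omega
      · omega
  have hx1 := h1 (γ.count x.1.1 - 1 - x.1.2) x hx (by have := x.2; omega)
  have hx2 := h2 _ x hx rfl
  have := x.2
  omega

/-- Normal coordinates of the curve: in the triangle `t`, exactly `c t i` loop segments lie at the
corner between the sides `i` and `i + 1`, and there are no other loop segments. -/
structure IsCornerCount (γ : T.SimpleLoop) (c : Tri → Fin 3 → ℕ) : Prop where
  count_eq : ∀ t i, γ.count (t, i) = c t (i + 2) + c t i
  partner_of_le : ∀ t i, ∀ x : Point γ.count, x.1.1 = (t, i) → c t (i + 2) ≤ x.1.2 →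
    (γ.partner x).1 = ((t, i + 1), γ.count (t, i) - 1 - x.1.2)
  partner_of_lt : ∀ t i, ∀ x : Point γ.count, x.1.1 = (t, i) → x.1.2 < c t (i + 2) →
    (γ.partner x).1 = ((t, i + 2), γ.count (t, i + 2) - 1 - x.1.2)

lemma NoBacktrack.exists_isCornerCount (h : γ.NoBacktrack) : ∃ c, γ.IsCornerCount c := by
  have hm : ∀ s : Tri × Fin 3, ∃ m ≤ γ.count s, ∀ x : Point γ.count, x.1.1 = s →
      ((γ.partner x).1.1.2 = x.1.1.2 + 1 ↔ m ≤ x.1.2) := by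
    intro s
    classical
    have hex : ∃ m, ∀ x : Point γ.count, x.1.1 = s → m ≤ x.1.2 →
        (γ.partner x).1.1.2 = x.1.1.2 + 1 :=
      ⟨γ.count s, fun x hx hle => by have := x.2; rw [hx] at this; omega⟩
    refine ⟨Nat.find hex, Nat.find_min' hex fun x hx hle => by
      have := x.2; rw [hx] at this; omega, fun x hx => ⟨fun hn => ?_, Nat.find_spec hex x hx⟩⟩
    refine Nat.find_min' hex fun y hy hle => ?_
    rcases hle.lt_or_eq with hlt | he
    · exact (h.partner_of_lt (hx.trans hy.symm) hlt hn).1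
    · rwa [← show x = y from Subtype.ext (Prod.ext (hx.trans hy.symm) he)]
  choose m hmle hm using hm
  -- Both sides of a corner have the same number of points joined across the corner.
  have hc : ∀ t i, m (t, i + 1) = γ.count (t, i) - m (t, i) := by
    intro t i
    have hle := hmle (t, i)
    have hle' := hmle (t, i + 1)
    apply le_antisymm
    · by_contra! hlt
      obtain ⟨z, hzs, hz2⟩ := exists_point (γ := γ) (hlt.trans_le hle')
      have hz : (γ.partner z).1.1.2 = i := by
        rcases h.partner_next_or z with hz | hz
        · rw [hm _ z hzs] at hz
          omega
        · rw [hz, hzs]; exact fin3_add_one_add_two i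
      have hs : (γ.partner z).1.1 = (t, i) :=
        Prod.ext ((γ.partner_triangle z).trans (by rw [hzs])) hz
      have hn : (γ.partner (γ.partner z)).1.1.2 = (γ.partner z).1.1.2 + 1 := by
        rw [γ.partner_partner, hz, hzs]
      have h1 := h.partner_add _ hn
      rw [hm _ _ hs] at hn
      rw [γ.partner_partner, hs] at h1
      omega
    · by_contra! hlt
      obtain ⟨x, hxs, hx2⟩ := exists_point (γ := γ) (s := (t, i))
        (p := γ.count (t, i) - 1 - m (t, i + 1)) (by omega)
      have hx : (γ.partner x).1.1.2 = x.1.1.2 + 1 := by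
        rw [hm _ x hxs]; omega
      have h1 := h.partner_add x hx
      have hs : (γ.partner x).1.1 = (t, i + 1) :=
        Prod.ext ((γ.partner_triangle x).trans (by rw [hxs])) (hx.trans (by rw [hxs]))
      rw [hxs] at h1
      have hn := (hm _ _ hs).2 (by omega)
      rw [γ.partner_partner, hx] at hn
      exact fin3_add_one_add_one_ne _ hn.symm
  have key : ∀ t i, ∀ x : Point γ.count, x.1.1 = (t, i) → m (t, i) ≤ x.1.2 →
      (γ.partner x).1 = ((t, i + 1), γ.count (t, i) - 1 - x.1.2) := by
    intro t i x hx hle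
    have hn := (hm _ x hx).2 hle
    have h1 := h.partner_add x hn
    rw [hx] at hn h1
    refine Prod.ext (Prod.ext ?_ hn) ?_
    · rw [γ.partner_triangle, hx]
    · simp only; omega
  have hcm : ∀ t i, γ.count (t, i + 2) - m (t, i + 2) = m (t, i) := fun t i => by
    rw [← hc, fin3_add_two_add_one]
  refine ⟨fun t i => γ.count (t, i) - m (t, i), ⟨fun t i => ?_, fun t i x hx hle => ?_,
    fun t i x hx hlt => ?_⟩⟩
  · have := hcm t i
    have := hmle (t, i)
    omega
  · rw [hcm] at hle
    exact key t i x hx hle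
  · have hle := hmle (t, i + 2)
    have hcmi := hcm t i
    let y : Point γ.count := ⟨((t, i + 2), γ.count (t, i + 2) - 1 - x.1.2), by simp only; omega⟩
    have hy := key t (i + 2) y rfl (by simp only [y]; omega)
    have : γ.partner y = x := Subtype.ext (hy.trans (Prod.ext (by
      rw [hx]; simp only [fin3_add_two_add_one]) (by simp only [y]; omega)))
    rw [partner_eq_of_eq this]

/-! ### Small regions in normal coordinates -/

/-- The arc segment `a` lies in the corner of its triangle that is cut off by the loop segment
`{x, partner x}`, where `partner x` is on the side following the side of `x`. -/
def AtCorner (a : (Tri × Fin 3) × ℕ) (x : Point γ.count) : Prop :=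
  (a.1.2 = x.1.1.2 ∧ x.1.2 < a.2) ∨ (a.1.2 = x.1.1.2 + 1 ∧ a.2 ≤ (γ.partner x).1.2)

lemma onOuterPart_iff (a : γ.Piece) (x : Point γ.count)
    (hx : (γ.partner x).1.1.2 = x.1.1.2 + 1) :
    γ.OnOuterPart a x ↔ (AtCorner a.1 x ↔ x.1.1.2 = 2) := by
  simp only [OnOuterPart, PieceBefore, AtCorner, hx]
  generalize x.1.1.2 = i
  generalize a.1.1.2 = j
  fin_cases i <;> fin_cases j <;> simp [iff_comm]

lemma onOuterPart_partner (a : γ.Piece) (x : Point γ.count) :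
    γ.OnOuterPart a (γ.partner x) ↔ γ.OnOuterPart a x := by
  simp only [OnOuterPart, γ.partner_partner]
  exact iff_comm

lemma NoBacktrack.vertexOf_eq_iff (h : γ.NoBacktrack) (a b : γ.End) :
    γ.vertexOf a = γ.vertexOf b ↔ a.1.1.1 = b.1.1.1 ∧ ∀ x : Point γ.count, x.1.1.1 = a.1.1.1 →
      (γ.partner x).1.1.2 = x.1.1.2 + 1 → (AtCorner a.1 x ↔ AtCorner b.1 x) := by
  have h0 : γ.vertexOf a = γ.vertexOf b ↔ a.1.1.1 = b.1.1.1 ∧ ∀ x : Point γ.count,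
      x.1.1.1 = a.1.1.1 → (γ.OnOuterPart ⟨a.1, a.2.2.le⟩ x ↔ γ.OnOuterPart ⟨b.1, b.2.2.le⟩ x) :=
    Subtype.ext_iff.trans Quotient.eq
  rw [h0]
  refine and_congr_right fun _ => ⟨fun H x hx hn => ?_, fun H x hx => ?_⟩
  · have := H x hx
    rw [onOuterPart_iff _ x hn, onOuterPart_iff _ x hn] at this
    by_cases e : x.1.1.2 = 2
    · simpa [e] using this
    · simpa [e, not_iff_not] using this
  · rcases h.partner_next_or x with hn | hn
    · rw [onOuterPart_iff _ x hn, onOuterPart_iff _ x hn, H x hx hn]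
    · rw [← onOuterPart_partner, ← onOuterPart_partner ⟨b.1, _⟩]
      have hn' : (γ.partner (γ.partner x)).1.1.2 = (γ.partner x).1.1.2 + 1 := by
        rw [γ.partner_partner, hn, fin3_add_two_add_one]
      rw [onOuterPart_iff _ _ hn', onOuterPart_iff _ _ hn',
        H _ ((γ.partner_triangle x).trans hx) hn']

namespace IsCornerCount

variable {c : Tri → Fin 3 → ℕ}

/-- Two ends belong to the same narrow region if and only if no loop segment cuts off a corner
with exactly one of them; the segments at the corner `i` are numbered by `q`, from the corner on. -/
lemma vertexOf_eq_iff (hc : γ.IsCornerCount c) (h : γ.NoBacktrack) (a b : γ.End) :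
    γ.vertexOf a = γ.vertexOf b ↔ a.1.1.1 = b.1.1.1 ∧ ∀ i q, q < c a.1.1.1 i →
      (((a.1.1.2 = i ∧ γ.count (a.1.1.1, i) ≤ a.1.2 + q) ∨ (a.1.1.2 = i + 1 ∧ a.1.2 ≤ q)) ↔
      ((b.1.1.2 = i ∧ γ.count (a.1.1.1, i) ≤ b.1.2 + q) ∨ (b.1.1.2 = i + 1 ∧ b.1.2 ≤ q))) := by
  rw [h.vertexOf_eq_iff]
  refine and_congr_right fun hab => ?_
  generalize a.1.1.1 = t at *
  constructor
  · intro H i q hq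
    have hcount := hc.count_eq t i
    obtain ⟨x, hxs, hx2⟩ := exists_point (γ := γ) (s := (t, i))
      (p := γ.count (t, i) - 1 - q) (by omega)
    have hp := hc.partner_of_le t i x hxs (by omega)
    have := H x (by rw [hxs]) (by rw [hp, hxs])
    simp only [AtCorner, hp, hxs] at this
    rw [show γ.count (t, i) - 1 - x.1.2 = q by omega] at this
    rw [hx2] at this
    convert this using 4 <;> omega
  · intro H x hx hn
    obtain ⟨i, hi⟩ : ∃ i, x.1.1 = (t, i) := ⟨x.1.1.2, Prod.ext hx rfl⟩
    have hlt := x.2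
    have hle : c t (i + 2) ≤ x.1.2 := by
      by_contra! hlt
      have := hc.partner_of_lt t i x hi hlt
      rw [this, hi] at hn
      have e : i + 2 ≠ i + 1 := by clear * -; revert i; decide
      exact e hn
    have hp := hc.partner_of_le t i x hi hle
    have hcount := hc.count_eq t i
    rw [hi] at hlt
    have := H i (γ.count (t, i) - 1 - x.1.2) (by omega)
    simp only [AtCorner, hp, hi]
    convert this using 4 <;> omega

lemma eq_of_vertexOf_eq (hc : γ.IsCornerCount c) (h : γ.NoBacktrack) {a b : γ.End}
    (hs : a.1.1 = b.1.1) (hv : γ.vertexOf a = γ.vertexOf b) : a = b := by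
  obtain ⟨-, H⟩ := (hc.vertexOf_eq_iff h a b).1 hv
  obtain ⟨⟨⟨t, i⟩, k⟩, hk⟩ := a
  obtain ⟨⟨⟨t', i'⟩, k'⟩, hk'⟩ := b
  simp only [Prod.mk.injEq] at hs
  obtain ⟨rfl, rfl⟩ := hs
  simp only at H hk hk'
  have hcount := hc.count_eq t i
  have e : i = i + 2 + 1 := (fin3_add_two_add_one i).symm
  have e' : i ≠ i + 2 := by clear * -; revert i; decide
  have e'' : i ≠ i + 1 := by clear * -; revert i; decide
  have A : ∀ q < c t i, (γ.count (t, i) ≤ k + q ↔ γ.count (t, i) ≤ k' + q) := fun q hq => by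
    simpa [e''] using H i q hq
  have B : ∀ q < c t (i + 2), (k ≤ q ↔ k' ≤ q) := fun q hq => by
    simpa [e', ← e] using H (i + 2) q hq
  have A1 := A (γ.count (t, i) - k)
  have A2 := A (γ.count (t, i) - k')
  have B1 := B k
  have B2 := B k'
  have : k = k' := by omega
  subst this
  rfl

/-- Two ends on consecutive sides belong to the same narrow region if and only if no loop
segment at their common corner separates them, and they lie in the union of this corner and the
central region. -/
lemma vertexOf_eq_iff_of_next (hc : γ.IsCornerCount c) (h : γ.NoBacktrack) {a b : γ.End} {t i}
    (ha : a.1.1 = (t, i)) (hb : b.1.1 = (t, i + 1)) :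
    γ.vertexOf a = γ.vertexOf b ↔ c t (i + 2) ≤ a.1.2 ∧ a.1.2 + b.1.2 = γ.count (t, i) := by
  rw [hc.vertexOf_eq_iff h]
  obtain ⟨⟨s, k⟩, hk⟩ := a
  obtain ⟨⟨s', k'⟩, hk'⟩ := b
  simp only at ha hb
  subst ha hb
  simp only at hk hk' ⊢
  have h0 := hc.count_eq t i
  have h1 := hc.count_eq t (i + 1)
  rw [fin3_add_one_add_two] at h1
  have e1 : i ≠ i + 1 := by clear * -; revert i; decide
  have e2 : i ≠ i + 2 := by clear * -; revert i; decide
  have e3 : i + 1 ≠ i + 2 := by clear * -; revert i; decide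
  have e4 : i + 1 ≠ i := e1.symm
  have e5 : i ≠ i + 1 + 1 := by rw [fin3_add_one_add_one]; exact e2
  have e6 : i + 1 ≠ i + 1 + 1 := by rw [fin3_add_one_add_one]; exact e3
  have e7 : i + 2 + 1 = i := fin3_add_two_add_one i
  constructor
  · rintro ⟨-, H⟩
    have A : ∀ q < c t i, (γ.count (t, i) ≤ k + q ↔ k' ≤ q) := fun q hq => by
      simpa [e1] using H i q hq
    have B : ∀ q < c t (i + 1), ¬ (γ.count (t, i + 1) ≤ k' + q) := fun q hq hle => by
      have := H (i + 1) q hq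
      simp only [e1, e5, e6, false_and, or_self, true_and, or_false, false_iff] at this
      exact this hle
    have C : ∀ q < c t (i + 2), ¬ k ≤ q := fun q hq hle => by
      have := H (i + 2) q hq
      simp only [e2, e3, e4, e7, false_and, or_self, true_and, false_or, iff_false] at this
      exact this hle
    have C1 := C (c t (i + 2) - 1)
    have B1 := B (c t (i + 1) - 1)
    have A1 := A (γ.count (t, i) - k)
    have A2 := A k'
    omega
  · rintro ⟨hle, hkk⟩
    refine ⟨trivial, fun j q hq => ?_⟩
    have hj : j = i ∨ j = i + 1 ∨ j = i + 2 := by clear * -; revert i j; decide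
    rcases hj with rfl | rfl | rfl
    · simp [e1]
      omega
    · simp only [e1, e5, e6, false_and, or_self, true_and, or_false, false_iff]
      omega
    · simp only [e2, e3, e4, e7, false_and, or_self, true_and, false_or, iff_false]
      omega

end IsCornerCount

/-! ### Narrow regions and their types -/

lemma exists_end {s : Tri × Fin 3} {k : ℕ} (h0 : 0 < k) (h : k < γ.count s) :
    ∃ a : γ.End, a.1.1 = s ∧ a.1.2 = k := ⟨⟨(s, k), h0, h⟩, rfl, rfl⟩

lemma flip_side_ne (a : γ.End) : (γ.flip a).1.1 ≠ a.1.1 :=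
  glue_ne_of_point (γ.endPoint a)

lemma isTypeI_flip (a : γ.End) :
    γ.IsTypeI (γ.vertexOf (γ.flip a)) ↔ γ.IsTypeI (γ.vertexOf a) := by
  have : γ.regionalGraph.connectedComponentMk (γ.vertexOf (γ.flip a)) =
      γ.regionalGraph.connectedComponentMk (γ.vertexOf a) := by
    by_cases h : γ.vertexOf a = γ.vertexOf (γ.flip a)
    · rw [h]
    · refine (SimpleGraph.ConnectedComponent.sound (SimpleGraph.Adj.reachable ?_)).symm
      rw [regionalGraph, SimpleGraph.fromRel_adj]
      exact ⟨h, Or.inl ⟨a, rfl, rfl⟩⟩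
  rw [IsTypeI, IsTypeI, this]

lemma isTypeI_of_valence_eq_one {v : γ.NarrowRegion} (h : γ.valence v = 1) : γ.IsTypeI v :=
  ⟨v, rfl, h⟩

namespace IsCornerCount

variable {c : Tri → Fin 3 → ℕ}

/-- The ends at the vertex of `a`, other than `a` itself, lie on the other two sides. -/
lemma end_cases (hc : γ.IsCornerCount c) (h : γ.NoBacktrack) {a d : γ.End} {t i}
    (ha : a.1.1 = (t, i)) (hd : γ.vertexOf d = γ.vertexOf a) :
    d = a ∨ (d.1.1 = (t, i + 1) ∧ c t (i + 2) ≤ a.1.2 ∧ a.1.2 + d.1.2 = γ.count (t, i)) ∨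
      (d.1.1 = (t, i + 2) ∧ c t (i + 1) ≤ d.1.2 ∧ d.1.2 + a.1.2 = γ.count (t, i + 2)) := by
  have ht : d.1.1.1 = t := by rw [((hc.vertexOf_eq_iff h d a).1 hd).1, ha]
  by_cases hi : d.1.1.2 = i
  · exact Or.inl (hc.eq_of_vertexOf_eq h (by rw [ha]; exact Prod.ext ht hi) hd)
  right
  rcases fin3_cases hi with hi | hi
  · have hds : d.1.1 = (t, i + 1) := Prod.ext ht hi
    exact Or.inl ⟨hds, (hc.vertexOf_eq_iff_of_next h ha hds).1 hd.symm⟩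
  · have hds : d.1.1 = (t, i + 2) := Prod.ext ht hi
    have := (hc.vertexOf_eq_iff_of_next h hds (by rw [ha, fin3_add_two_add_one])).1 hd
    rw [fin3_add_two_add_two] at this
    exact Or.inr ⟨hds, this⟩

/-- The region between two adjacent parallel loop segments has two ends. -/
lemma endsAt_eq_pair (hc : γ.IsCornerCount c) (h : γ.NoBacktrack) {a b : γ.End} {t i}
    (ha : a.1.1 = (t, i)) (hb : b.1.1 = (t, i + 1)) (hlt : c t (i + 2) < a.1.2)
    (hab : a.1.2 + b.1.2 = γ.count (t, i)) : γ.endsAt (γ.vertexOf a) = {a, b} := by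
  have hv := (hc.vertexOf_eq_iff_of_next h ha hb).2 ⟨hlt.le, hab⟩
  ext d
  change γ.vertexOf d = γ.vertexOf a ↔ d = a ∨ d = b
  constructor
  · intro hd
    rcases hc.end_cases h ha hd with hd' | ⟨hs, -⟩ | ⟨-, h1, h2⟩
    · exact Or.inl hd'
    · exact Or.inr (hc.eq_of_vertexOf_eq h (hs.trans hb.symm) (hd.trans hv))
    · have := hc.count_eq t (i + 2)
      rw [fin3_add_two_add_two] at this
      omega
  · rintro (rfl | rfl)
    · rfl
    · exact hv.symm

/-- If a triangle has loop segments at two of its corners only, then its central region has only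
one end. -/
lemma valence_eq_one (hc : γ.IsCornerCount c) (h : γ.NoBacktrack) {a : γ.End} {t i}
    (ha : a.1.1 = (t, i)) (hk : a.1.2 = c t (i + 2)) (h0 : c t (i + 1) = 0) :
    γ.valence (γ.vertexOf a) = 1 := by
  rw [valence, Set.ncard_eq_one]
  refine ⟨a, Set.eq_singleton_iff_unique_mem.2 ⟨rfl, fun d hd => ?_⟩⟩
  have e0 := hc.count_eq t i
  have e1 := hc.count_eq t (i + 1)
  have e2 := hc.count_eq t (i + 2)
  rw [fin3_add_one_add_two] at e1
  rw [fin3_add_two_add_two] at e2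
  have hd2 := d.2
  rcases hc.end_cases h ha hd with hd' | ⟨hs, h1, h2⟩ | ⟨hs, h1, h2⟩
  · exact hd'
  · rw [hs] at hd2
    omega
  · rw [hs] at hd2
    omega

lemma injOn_side_endsAt (hc : γ.IsCornerCount c) (h : γ.NoBacktrack) (v : γ.NarrowRegion) :
    Set.InjOn (fun a : γ.End => a.1.1.2) (γ.endsAt v) := fun a ha b hb hab => by
  have hv : γ.vertexOf a = γ.vertexOf b := Eq.trans ha (Eq.symm hb)
  exact hc.eq_of_vertexOf_eq h (Prod.ext ((hc.vertexOf_eq_iff h a b).1 hv).1 hab) hv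

lemma valence_le_three (hc : γ.IsCornerCount c) (h : γ.NoBacktrack) (v : γ.NarrowRegion) :
    γ.valence v ≤ 3 := by
  have := Set.ncard_le_ncard_of_injOn (t := Set.univ) _ (fun _ _ => Set.mem_univ _)
    (hc.injOn_side_endsAt h v)
  rw [valence]
  simpa [Set.ncard_univ] using this

lemma finite_endsAt (hc : γ.IsCornerCount c) (h : γ.NoBacktrack) (v : γ.NarrowRegion) :
    (γ.endsAt v).Finite :=
  Set.Finite.of_finite_image (Set.toFinite _) (hc.injOn_side_endsAt h v)

end IsCornerCount

/-- The two arc segments next to the point `x` are inner arc segments and border narrow regions of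
type II. -/
def BetweenTypeII (x : Point γ.count) : Prop :=
  ∃ a b : γ.End, (a.1.1 = x.1.1 ∧ a.1.2 = x.1.2 ∧ ¬ γ.IsTypeI (γ.vertexOf a)) ∧
    b.1.1 = x.1.1 ∧ b.1.2 = x.1.2 + 1 ∧ ¬ γ.IsTypeI (γ.vertexOf b)

lemma BetweenTypeII.across {x : Point γ.count} (hx : BetweenTypeII x) :
    BetweenTypeII (γ.across x) := by
  obtain ⟨a, b, ⟨has, hak, ha⟩, hbs, hbk, hb⟩ := hx
  have h2 := b.2
  have h3 := a.2
  rw [hbs] at h2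
  refine ⟨γ.flip b, γ.flip a, ⟨?_, ?_, ?_⟩, ?_, ?_, ?_⟩
  · simp [flip, SimpleLoop.across, hbs]
  · simp only [flip, SimpleLoop.across, hbs]; omega
  · rwa [isTypeI_flip]
  · simp [flip, SimpleLoop.across, has]
  · simp only [flip, SimpleLoop.across, has]; omega
  · rwa [isTypeI_flip]

/-- On either side of a loop segment, the narrow region along it is the same at both
endpoints, unless it has only one end. -/
lemma BetweenTypeII.partner {c : Tri → Fin 3 → ℕ} (hc : γ.IsCornerCount c) (h : γ.NoBacktrack)
    {x : Point γ.count} (hx : BetweenTypeII x) : BetweenTypeII (γ.partner x) := by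
  obtain ⟨a, b, ⟨has, hak, ha⟩, hbs, hbk, hb⟩ := hx
  have h2 := b.2
  have h3 := a.2
  obtain ⟨t, i, hs⟩ : ∃ t i, x.1.1 = (t, i) := ⟨_, _, rfl⟩
  rw [hs] at has hbs
  rw [hbs] at h2
  have e0 := hc.count_eq t i
  have e1 := hc.count_eq t (i + 1)
  have e2 := hc.count_eq t (i + 2)
  rw [fin3_add_one_add_two] at e1
  rw [fin3_add_two_add_two] at e2
  rcases le_or_gt (c t (i + 2)) x.1.2 with hle | hlt
  · have hp := hc.partner_of_le t i x hs hle
    have hne : x.1.2 ≠ c t (i + 2) ∨ c t (i + 1) ≠ 0 := by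
      by_contra! hh
      exact ha (isTypeI_of_valence_eq_one (hc.valence_eq_one h has (hak.trans hh.1) hh.2))
    obtain ⟨a', has', hak'⟩ := exists_end (γ := γ) (s := (t, i + 1))
      (k := γ.count (t, i) - x.1.2) (by omega) (by omega)
    obtain ⟨b', hbs', hbk'⟩ := exists_end (γ := γ) (s := (t, i + 1))
      (k := γ.count (t, i) - 1 - x.1.2) (by omega) (by omega)
    refine ⟨b', a', ⟨by rw [hp, hbs'], by rw [hp, hbk'], ?_⟩, by rw [hp, has'], ?_, ?_⟩
    · rwa [← (hc.vertexOf_eq_iff_of_next h hbs hbs').2 ⟨by omega, by omega⟩]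
    · rw [hp, hak']; simp only; omega
    · rwa [← (hc.vertexOf_eq_iff_of_next h has has').2 ⟨by omega, by omega⟩]
  · have hp := hc.partner_of_lt t i x hs hlt
    have hne : x.1.2 + 1 ≠ c t (i + 2) ∨ c t (i + 1) ≠ 0 := by
      by_contra! hh
      exact hb (isTypeI_of_valence_eq_one (hc.valence_eq_one h hbs (hbk.trans hh.1) hh.2))
    obtain ⟨a', has', hak'⟩ := exists_end (γ := γ) (s := (t, i + 2))
      (k := γ.count (t, i + 2) - x.1.2) (by omega) (by omega)
    obtain ⟨b', hbs', hbk'⟩ := exists_end (γ := γ) (s := (t, i + 2))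
      (k := γ.count (t, i + 2) - 1 - x.1.2) (by omega) (by omega)
    rw [← fin3_add_two_add_one i] at has hbs
    refine ⟨b', a', ⟨by rw [hp, hbs'], by rw [hp, hbk'], ?_⟩, by rw [hp, has'], ?_, ?_⟩
    · rwa [(hc.vertexOf_eq_iff_of_next h hbs' hbs).2
        ⟨by rw [fin3_add_two_add_two]; omega, by omega⟩]
    · rw [hp, hak']; simp only; omega
    · rwa [(hc.vertexOf_eq_iff_of_next h has' has).2
        ⟨by rw [fin3_add_two_add_two]; omega, by omega⟩]

/-- The narrow regions on the two sides of a point of the curve are not both of type II: otherwise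
this would hold all along the curve, but the first point on a side is next to a vertex. -/
lemma not_betweenTypeII {c : Tri → Fin 3 → ℕ} (hc : γ.IsCornerCount c) (h : γ.NoBacktrack)
    (x : Point γ.count) : ¬ BetweenTypeII x := by
  intro hx
  have key : ∀ y z : Point γ.count, Relation.EqvGen (fun a b : Point γ.count => b = γ.partner a ∨
      b.1 = (T.glue a.1.1, γ.count a.1.1 - 1 - a.1.2)) y z →
      (BetweenTypeII y ↔ BetweenTypeII z) := by
    intro y z hyz
    induction hyz with
    | rel y z hyz =>
      rcases hyz with rfl | hyz
      · refine ⟨fun H => H.partner hc h, fun H => ?_⟩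
        simpa only [γ.partner_partner] using H.partner hc h
      · obtain rfl : z = γ.across y := Subtype.ext hyz
        refine ⟨fun H => H.across, fun H => ?_⟩
        simpa only [across_across] using H.across
    | refl => rfl
    | symm _ _ _ ih => exact ih.symm
    | trans _ _ _ _ _ ih ih' => exact ih.trans ih'
  obtain ⟨y, -, hy⟩ := exists_point (γ := γ) (lt_of_le_of_lt (Nat.zero_le _) x.2)
  obtain ⟨a, -, ⟨-, hak, -⟩, -⟩ := (key x y (γ.connected x y)).1 hx
  have := a.2.1
  omega

/-! ### Heights with dyadic differences -/

/-- In a sum of numbers whose absolute values are distinct powers of two, the largest one exceeds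
the rest. -/
lemma abs_sum_sub_lt_two_pow {s : Finset ℕ} {e : ℕ → ℕ} {δ : ℕ → ℝ} (he : Set.InjOn e s)
    (hδ : ∀ k ∈ s, |δ k| = 2 ^ e k) {k₀ : ℕ} (hk : k₀ ∈ s) (hmax : ∀ k ∈ s, e k ≤ e k₀) :
    |∑ k ∈ s, δ k - δ k₀| < 2 ^ e k₀ := by
  rw [← Finset.add_sum_erase s δ hk, add_sub_cancel_left]
  have hsub : ∀ k ∈ s.erase k₀, k ∈ s := fun k h => Finset.mem_of_mem_erase h
  calc |∑ k ∈ s.erase k₀, δ k| ≤ ∑ k ∈ s.erase k₀, |δ k| := Finset.abs_sum_le_sum_abs _ _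
    _ = ∑ k ∈ s.erase k₀, (2 : ℝ) ^ e k := Finset.sum_congr rfl fun k h => hδ k (hsub k h)
    _ = ∑ j ∈ (s.erase k₀).image e, (2 : ℝ) ^ j :=
      (Finset.sum_image fun k hk l hl h => he (hsub k hk) (hsub l hl) h).symm
    _ = ((∑ j ∈ (s.erase k₀).image e, 2 ^ j : ℕ) : ℝ) := by push_cast; rfl
    _ < ((2 ^ e k₀ : ℕ) : ℝ) := by
      refine Nat.cast_lt.2 (Nat.geomSum_lt le_rfl fun j hj => ?_)
      obtain ⟨k, hk', rfl⟩ := Finset.mem_image.1 hj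
      exact lt_of_le_of_ne (hmax k (hsub k hk')) fun h =>
        Finset.ne_of_mem_erase hk' (he (hsub k hk') hk h)
    _ = 2 ^ e k₀ := by push_cast; rfl

/-- The inner arc segments, seen from one side, between the points `x` and `y` of this side. -/
def endsBetween (x y : Point γ.count) : Set γ.End :=
  {a | a.1.1 = x.1.1 ∧ x.1.2 < a.1.2 ∧ a.1.2 ≤ y.1.2}

instance [Finite Tri] : Finite γ.End :=
  Finite.of_injective γ.endPoint fun _ _ h => Subtype.ext (congrArg (fun z : Point γ.count => z.1) h)

lemma EdgeData.exists_max (D : γ.EdgeData) [Finite Tri] {S : Set γ.End} (hS : S.Nonempty) :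
    ∃ a ∈ S, ∀ b ∈ S, D.weight b ≤ D.weight a :=
  Set.exists_max_image S D.weight S.toFinite hS

lemma endsBetween_nonempty {x y : Point γ.count} (hs : x.1.1 = y.1.1) (hlt : x.1.2 < y.1.2) :
    (endsBetween x y).Nonempty := by
  have := y.2
  rw [← hs] at this
  obtain ⟨a, ha, hk⟩ := exists_end (γ := γ) (Nat.zero_lt_of_lt hlt) this
  exact ⟨a, ha, by omega, by omega⟩

namespace EdgeData.DistinctDyadicWeights

variable {D : γ.EdgeData}

lemma eq_of_side_eq (h1 : D.DistinctDyadicWeights) {a b : γ.End} (hs : a.1.1 = b.1.1)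
    (hw : D.weight a = D.weight b) : a = b := by
  rcases h1.2 a b hw with h | h
  · exact h.symm
  · exact absurd (h ▸ hs.symm) (flip_side_ne a)

lemma eq_of_incoming_iff (h1 : D.DistinctDyadicWeights) {a b : γ.End}
    (hi : D.incoming a ↔ D.incoming b) (hw : D.weight a = D.weight b) : a = b := by
  rcases h1.2 a b hw with h | h
  · exact h.symm
  · rw [h, D.incoming_flip] at hi
    tauto

lemma weight_pos (h1 : D.DistinctDyadicWeights) (a : γ.End) : 0 < D.weight a := by
  obtain ⟨m, -, hm⟩ := h1.1 a
  rw [hm]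
  positivity

lemma isDyadic_transfer (h1 : D.DistinctDyadicWeights) : D.transfer.IsDyadic :=
  ⟨fun a => (h1.1 a).imp fun _ h => h.2, fun _ _ hs hw => h1.eq_of_side_eq hs hw⟩

/-- If `u < v` are two weights, then `2 * u ≤ v`. -/
lemma two_mul_le (h1 : D.DistinctDyadicWeights) {a b : γ.End} (h : D.weight a < D.weight b) :
    2 * D.weight a ≤ D.weight b := by
  obtain ⟨m, -, hm⟩ := h1.1 a
  obtain ⟨n, -, hn⟩ := h1.1 b
  rw [hm, hn] at h ⊢
  rw [pow_lt_pow_iff_right₀ one_lt_two] at h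
  rw [← pow_succ']
  exact pow_le_pow_right₀ one_le_two h

/-- The inner arc segment of largest difference number between two junctures of an arc decides
which of them is higher. -/
lemma height_lt (h1 : D.DistinctDyadicWeights) {π : Point γ.count → ℝ}
    (hπ : D.transfer.IsHeight π) {x y : Point γ.count} (hs : x.1.1 = y.1.1) {a : γ.End}
    (ha : a ∈ endsBetween x y) (hmax : ∀ b ∈ endsBetween x y, D.weight b ≤ D.weight a) :
    (D.incoming a → π y < π x) ∧ (¬ D.incoming a → π x < π y) := by
  obtain ⟨s, hxs⟩ : ∃ s, x.1.1 = s := ⟨_, rfl⟩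
  choose e he0 he using h1.1
  let f : ℕ → ℝ := fun p => if h : p < γ.count s then π ⟨(s, p), h⟩ else 0
  let e' : ℕ → ℕ := fun k => if h : 0 < k ∧ k < γ.count s then e ⟨(s, k), h⟩ else 0
  have hf : ∀ z : Point γ.count, z.1.1 = s → f z.1.2 = π z := by
    rintro ⟨⟨s', p⟩, hp⟩ rfl
    exact dif_pos hp
  have he' : ∀ b : γ.End, b.1.1 = s → e' b.1.2 = e b := by
    rintro ⟨⟨s', k⟩, hk⟩ rfl
    exact dif_pos hk
  have hδ : ∀ b : γ.End, b.1.1 = s → (D.incoming b → f b.1.2 - f (b.1.2 - 1) = - D.weight b) ∧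
      (¬ D.incoming b → f b.1.2 - f (b.1.2 - 1) = D.weight b) := by
    intro b hb
    have h2 := hf (γ.startPoint b) hb
    have h3 := hf (γ.endPoint b) hb
    simp only [startPoint] at h2
    simp only [endPoint] at h3
    rw [h2, h3]
    refine ⟨fun hi => ?_, (hπ.2 b).2⟩
    have : π (γ.startPoint b) - π (γ.endPoint b) = D.weight b := (hπ.2 b).1 hi
    simp only [startPoint, endPoint] at this
    linarith
  have hend : ∀ k ∈ Finset.Ioc x.1.2 y.1.2, ∃ b ∈ endsBetween x y, b.1.2 = k := by
    intro k hk
    rw [Finset.mem_Ioc] at hk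
    have hy := y.2
    rw [← hs] at hy
    obtain ⟨b, hbs, hbk⟩ := exists_end (γ := γ) (s := x.1.1) (k := k) (by omega) (by omega)
    exact ⟨b, ⟨hbs, by omega, by omega⟩, hbk⟩
  have htel : ∀ q, x.1.2 ≤ q → ∑ k ∈ Finset.Ioc x.1.2 q, (f k - f (k - 1)) = f q - f x.1.2 := by
    intro q hq
    induction q, hq using Nat.le_induction with
    | base => simp
    | succ q hq ih => rw [Finset.sum_Ioc_succ_top hq, ih, Nat.add_sub_cancel]; ring
  have hsum := abs_sum_sub_lt_two_pow (s := Finset.Ioc x.1.2 y.1.2) (e := e')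
    (δ := fun k => f k - f (k - 1)) (k₀ := a.1.2) ?_ ?_ (Finset.mem_Ioc.2 ha.2) ?_
  · rw [htel _ (ha.2.1.trans_le ha.2.2).le, he' a (ha.1.trans hxs), ← he a, hf x hxs,
      hf y (hs ▸ hxs), abs_lt] at hsum
    obtain ⟨hd1, hd2⟩ := hδ a (ha.1.trans hxs)
    refine ⟨fun hi => ?_, fun hi => ?_⟩
    · simp only [hd1 hi] at hsum; linarith
    · simp only [hd2 hi] at hsum; linarith
  · intro k hk l hl hkl
    obtain ⟨b, hb, rfl⟩ := hend k hk
    obtain ⟨b', hb', rfl⟩ := hend l hl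
    rw [he' b (hb.1.trans hxs), he' b' (hb'.1.trans hxs)] at hkl
    rw [h1.eq_of_side_eq (hb.1.trans hb'.1.symm) (by rw [he, he, hkl])]
  · intro k hk
    obtain ⟨b, hb, rfl⟩ := hend k hk
    obtain ⟨hd1, hd2⟩ := hδ b (hb.1.trans hxs)
    rw [he' b (hb.1.trans hxs), ← he b]
    have := h1.weight_pos b
    by_cases hi : D.incoming b
    · rw [hd1 hi, abs_neg, abs_of_pos this]
    · rw [hd2 hi, abs_of_pos this]
  · intro k hk
    obtain ⟨b, hb, rfl⟩ := hend k hk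
    rw [he' b (hb.1.trans hxs), he' a (ha.1.trans hxs)]
    have := hmax b hb
    rwa [he, he, pow_le_pow_iff_right₀ one_lt_two] at this

end EdgeData.DistinctDyadicWeights

/-- On every arc there is a function with the prescribed differences at adjacent junctures. -/
lemma ArcData.exists_isHeight (A : γ.ArcData) : ∃ π, A.IsHeight π := by
  classical
  let δ : Tri × Fin 3 → ℕ → ℝ := fun s k =>
    if h : 0 < k ∧ k < γ.count s then
      if A.forward ⟨(s, k), h⟩ then - A.number ⟨(s, k), h⟩ else A.number ⟨(s, k), h⟩
    else 0
  have hδ : ∀ a : γ.End, δ a.1.1 a.1.2 = if A.forward a then - A.number a else A.number a :=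
    fun a => dif_pos a.2
  have hflip : ∀ s, ∀ k ≤ γ.count s, δ (T.glue s) (γ.count s - k) = - δ s k := by
    intro s k hk
    by_cases h : 0 < k ∧ k < γ.count s
    · have h2 := hδ (γ.flip ⟨(s, k), h⟩)
      rw [A.number_flip] at h2
      simp only [A.forward_flip] at h2
      simp only [flip] at h2
      rw [h2, hδ ⟨(s, k), h⟩]
      split_ifs <;> simp_all
    · have hg := γ.count_glue s
      rw [show δ s k = 0 from dif_neg h, show δ (T.glue s) (γ.count s - k) = 0 from
        dif_neg (by rw [hg]; omega), neg_zero]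
  have hrefl : ∀ s, ∀ p ≤ γ.count s + 1, ∑ k ∈ Finset.range p, δ (T.glue s) k =
      ∑ k ∈ Finset.range (γ.count s + 1 - p), δ s k -
        ∑ k ∈ Finset.range (γ.count s + 1), δ s k := by
    intro s p hp
    induction p with
    | zero => simp
    | succ p ih =>
      have h2 := hflip s (γ.count s - p) (Nat.sub_le _ _)
      rw [show γ.count s - (γ.count s - p) = p by omega] at h2
      rw [Finset.sum_range_succ, ih (by omega), h2,
        show γ.count s + 1 - p = (γ.count s - p) + 1 by omega, Finset.sum_range_succ,
        show γ.count s + 1 - (p + 1) = γ.count s - p by omega]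
      ring
  -- Subtracting half of the total makes the function independent of the side
  -- from which the arc is seen.
  refine ⟨fun x => ∑ k ∈ Finset.range (x.1.2 + 1), δ x.1.1 k -
    (∑ k ∈ Finset.range (γ.count x.1.1 + 1), δ x.1.1 k) / 2, fun x => ?_, fun a => ?_⟩
  · have hx := x.2
    have h2 := hrefl x.1.1 (γ.count x.1.1 - x.1.2) (by omega)
    have h3 := hrefl x.1.1 (γ.count x.1.1 + 1) le_rfl
    simp only [across, γ.count_glue]
    rw [show γ.count x.1.1 - 1 - x.1.2 + 1 = γ.count x.1.1 - x.1.2 by omega, h2, h3,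
      show γ.count x.1.1 + 1 - (γ.count x.1.1 - x.1.2) = x.1.2 + 1 by omega, Nat.sub_self,
      Finset.sum_range_zero]
    ring
  · have h2 := hδ a
    have h3 := a.2.1
    simp only [startPoint, endPoint]
    rw [Nat.sub_add_cancel h3, Finset.sum_range_succ (δ a.1.1) a.1.2, h2]
    refine ⟨fun hf => ?_, fun hf => ?_⟩
    · rw [if_pos hf]; ring
    · rw [if_neg hf]; ring

namespace EdgeData.DistinctDyadicWeights

variable {D : γ.EdgeData} [Finite Tri]

lemma height_lt_iff (h1 : D.DistinctDyadicWeights) {π π' : Point γ.count → ℝ}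
    (hπ : D.transfer.IsHeight π) (hπ' : D.transfer.IsHeight π') {x y : Point γ.count}
    (hs : x.1.1 = y.1.1) : π x < π y ↔ π' x < π' y := by
  rcases lt_trichotomy x.1.2 y.1.2 with hlt | he | hlt
  · obtain ⟨a, ha, hmax⟩ := D.exists_max (endsBetween_nonempty hs hlt)
    have H := h1.height_lt hπ hs ha hmax
    have H' := h1.height_lt hπ' hs ha hmax
    by_cases hi : D.incoming a
    · exact iff_of_false (H.1 hi).not_gt (H'.1 hi).not_gt
    · exact iff_of_true (H.2 hi) (H'.2 hi)
  · rw [show x = y from Subtype.ext (Prod.ext hs he)]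
    exact iff_of_false (lt_irrefl _) (lt_irrefl _)
  · obtain ⟨a, ha, hmax⟩ := D.exists_max (endsBetween_nonempty hs.symm hlt)
    have H := h1.height_lt hπ hs.symm ha hmax
    have H' := h1.height_lt hπ' hs.symm ha hmax
    by_cases hi : D.incoming a
    · exact iff_of_true (H.1 hi) (H'.1 hi)
    · exact iff_of_false (H.2 hi).not_gt (H'.2 hi).not_gt

lemma height_ne (h1 : D.DistinctDyadicWeights) {π : Point γ.count → ℝ}
    (hπ : D.transfer.IsHeight π) {x y : Point γ.count} (hs : x.1.1 = y.1.1) (hne : x ≠ y) :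
    π x ≠ π y := by
  wlog hlt : x.1.2 < y.1.2 generalizing x y
  · refine (this hs.symm hne.symm (lt_of_le_of_ne (not_lt.1 hlt) fun he => ?_)).symm
    exact hne (Subtype.ext (Prod.ext hs he.symm))
  obtain ⟨a, ha, hmax⟩ := D.exists_max (endsBetween_nonempty hs hlt)
  have H := h1.height_lt hπ hs ha hmax
  by_cases hi : D.incoming a
  · exact (H.1 hi).ne'
  · exact (H.2 hi).ne

lemma exists_unique_yields (h1 : D.DistinctDyadicWeights) :
    ∃ O : γ.ArcOrdering, D.transfer.Yields O ∧
      ∀ O' : γ.ArcOrdering, D.transfer.Yields O' → O' = O := by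
  obtain ⟨π, hπ⟩ := D.transfer.exists_isHeight
  refine ⟨{ lt := fun x y => x.1.1 = y.1.1 ∧ π x < π y
            same_side := fun x y h => h.1
            irrefl := fun x h => lt_irrefl _ h.2
            trans := fun x y z h h' => ⟨h.1.trans h'.1, h.2.trans h'.2⟩
            total := fun x y hs hne => ?_
            lt_across := fun x y => ?_ }, ⟨π, hπ, fun x y hs => and_iff_right hs⟩, ?_⟩
  · exact (h1.height_ne hπ hs hne).lt_or_gt.imp (fun h => ⟨hs, h⟩) fun h => ⟨hs.symm, h⟩
  · rw [hπ.1, hπ.1]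
    refine and_congr_left fun _ => ⟨fun h => ?_, fun h => congrArg T.glue h⟩
    rw [← T.glue_glue x.1.1, ← T.glue_glue y.1.1]
    exact congrArg T.glue h
  · rintro O' ⟨π', hπ', hO'⟩
    ext x y
    refine ⟨fun h => ?_, fun h => ?_⟩
    · have hs := O'.same_side x y h
      exact ⟨hs, (h1.height_lt_iff hπ hπ' hs).2 ((hO' x y hs).1 h)⟩
    · exact (hO' x y h.1).2 ((h1.height_lt_iff hπ hπ' h.1).1 h.2)

end EdgeData.DistinctDyadicWeights

/-! ### Compatibility -/

/-- At a region between two parallel loop segments, the flow goes from one end to the other. -/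
lemma EdgeData.FlowAtTwoValent.pair {D : γ.EdgeData} (h2 : D.FlowAtTwoValent) {a b : γ.End}
    (hne : a ≠ b) (hab : γ.endsAt (γ.vertexOf a) = {a, b}) :
    (D.incoming a ∧ ¬ D.incoming b ∧ D.weight b = 2 * D.weight a) ∨
    (¬ D.incoming a ∧ D.incoming b ∧ D.weight a = 2 * D.weight b) := by
  obtain ⟨a', b', m, hab', hia, hwa, hib, hwb⟩ := h2 (γ.vertexOf a) (by
    rw [valence, hab, Set.ncard_pair hne])
  have hw : D.weight b' = 2 * D.weight a' := by rw [hwa, hwb, pow_succ']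
  have ha' : a' = a ∨ a' = b := (hab ▸ hab' ▸ Set.mem_insert a' {b'} : a' ∈ ({a, b} : Set γ.End))
  have hb' : b' = a ∨ b' = b := (hab ▸ hab' ▸ Set.mem_insert_of_mem a' rfl :
    b' ∈ ({a, b} : Set γ.End))
  rcases ha' with rfl | rfl <;> rcases hb' with rfl | rfl
  · exact absurd hia hib
  · exact Or.inl ⟨hia, hib, hw⟩
  · exact Or.inr ⟨hib, hia, hw⟩
  · exact absurd hia hib

/-- Two parallel loop segments are in the same order at both ends: the dominant inner arc segments
between them belong to the same narrow region. -/
lemma IsCornerCount.height_lt_partner_iff [Finite Tri] {c : Tri → Fin 3 → ℕ}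
    (hc : γ.IsCornerCount c) (h : γ.NoBacktrack) {D : γ.EdgeData} (h1 : D.DistinctDyadicWeights)
    (h2 : D.FlowAtTwoValent) {π : Point γ.count → ℝ} (hπ : D.transfer.IsHeight π)
    {x y : Point γ.count} {t i} (hxs : x.1.1 = (t, i)) (hys : y.1.1 = (t, i))
    (hx : c t (i + 2) ≤ x.1.2) (hlt : x.1.2 < y.1.2) :
    (π x < π y ↔ π (γ.partner x) < π (γ.partner y)) ∧
    (π y < π x ↔ π (γ.partner y) < π (γ.partner x)) := by
  have hpx := hc.partner_of_le t i x hxs hx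
  have hpy := hc.partner_of_le t i y hys (by omega)
  have hyl := y.2
  rw [hys] at hyl
  have hcount := hc.count_eq t i
  have hcount' := hc.count_eq t (i + 1)
  rw [fin3_add_one_add_two] at hcount'
  have hsides : (t, i) ≠ (t, i + 1) := by
    intro e
    have : i ≠ i + 1 := by clear * -; revert i; decide
    exact this (congrArg Prod.snd e)
  have flow : ∀ a ∈ endsBetween x y, ∀ b : γ.End, b.1.1 = (t, i + 1) →
      a.1.2 + b.1.2 = γ.count (t, i) →
      (D.incoming a ∧ ¬ D.incoming b ∧ D.weight b = 2 * D.weight a) ∨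
      (¬ D.incoming a ∧ D.incoming b ∧ D.weight a = 2 * D.weight b) := by
    rintro a ⟨has, hxa, hay⟩ b hbs hab
    rw [hxs] at has
    refine h2.pair ?_ (hc.endsAt_eq_pair h has hbs (by omega) hab)
    rintro rfl
    exact hsides (has.symm.trans hbs)
  obtain ⟨a, ha, hmax⟩ := D.exists_max (endsBetween_nonempty (hxs.trans hys.symm) hlt)
  obtain ⟨has, hxa, hay⟩ := id ha
  have ha2 := a.2
  rw [has, hxs] at ha2
  rw [hxs] at has
  obtain ⟨b, hbs, hbk⟩ := exists_end (γ := γ) (s := (t, i + 1)) (k := γ.count (t, i) - a.1.2)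
    (by omega) (by omega)
  have hb : b ∈ endsBetween (γ.partner y) (γ.partner x) :=
    ⟨by rw [hbs, hpy], by rw [hpy]; simp only; omega, by rw [hpx]; simp only; omega⟩
  have hfab := flow a ha b hbs (by omega)
  have hmaxb : ∀ b' ∈ endsBetween (γ.partner y) (γ.partner x), D.weight b' ≤ D.weight b := by
    rintro b' ⟨hbs', hyb, hbx⟩
    rw [hpy] at hbs' hyb
    rw [hpx] at hbx
    simp only at hbs' hyb hbx
    obtain ⟨a', has', hak'⟩ := exists_end (γ := γ) (s := (t, i)) (k := γ.count (t, i) - b'.1.2)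
      (by omega) (by omega)
    have ha' : a' ∈ endsBetween x y := ⟨by rw [has', hxs], by omega, by omega⟩
    have hfab' := flow a' ha' b' hbs' (by omega)
    by_cases haa : a' = a
    · have : b' = b := Subtype.ext (Prod.ext (hbs'.trans hbs.symm) (by subst haa; omega))
      rw [this]
    have hwlt : D.weight a' < D.weight a := lt_of_le_of_ne (hmax a' ha') fun e =>
      haa (h1.eq_of_side_eq (has'.trans has.symm) e)
    have hwle := h1.two_mul_le hwlt
    have hpa := h1.weight_pos a
    have hpb' := h1.weight_pos b'
    rcases hfab with ⟨hia, hib, hw⟩ | ⟨hia, hib, hw⟩ <;>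
      rcases hfab' with ⟨hia', hib', hw'⟩ | ⟨hia', hib', hw'⟩
    · linarith
    · linarith
    · -- The weight of `b'` is at most that of `a`, and they differ since both edges are outgoing.
      have hne : D.weight b' ≠ D.weight a := fun e => by
        have := h1.eq_of_incoming_iff (iff_of_false hib' hia) e
        rw [this] at hbs'
        exact hsides (has.symm.trans hbs')
      have := h1.two_mul_le (lt_of_le_of_ne (by linarith) hne)
      linarith
    · linarith
  have H := h1.height_lt hπ (hxs.trans hys.symm) ha hmax
  have H' := h1.height_lt hπ (by rw [hpx, hpy]) hb hmaxb
  rcases hfab with ⟨hia, hib, -⟩ | ⟨hia, hib, -⟩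
  · have e := H.1 hia
    have e' := H'.2 hib
    exact ⟨iff_of_false e.not_gt e'.not_gt, iff_of_true e e'⟩
  · have e := H.2 hia
    have e' := H'.1 hib
    exact ⟨iff_of_true e e', iff_of_false e.not_gt e'.not_gt⟩

lemma IsCornerCount.le_iff {c : Tri → Fin 3 → ℕ} (hc : γ.IsCornerCount c) {x : Point γ.count}
    {t i} (hxs : x.1.1 = (t, i)) : c t (i + 2) ≤ x.1.2 ↔ (γ.partner x).1.1 = (t, i + 1) := by
  refine ⟨fun hle => by rw [hc.partner_of_le t i x hxs hle], fun hp => ?_⟩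
  by_contra! hlt
  rw [hc.partner_of_lt t i x hxs hlt] at hp
  have : i + 2 ≠ i + 1 := by clear * -; revert i; decide
  exact this (congrArg Prod.snd hp)

lemma IsCornerCount.compatibleAt [Finite Tri] {c : Tri → Fin 3 → ℕ} (hc : γ.IsCornerCount c)
    (h : γ.NoBacktrack) {D : γ.EdgeData} (h1 : D.DistinctDyadicWeights)
    (h2 : D.FlowAtTwoValent) {O : γ.ArcOrdering} (hO : D.transfer.Yields O) (t : Tri) :
    O.CompatibleAt t := by
  obtain ⟨π, hπ, hO⟩ := hO
  have key : ∀ i, ∀ x y : Point γ.count, x.1.1 = (t, i) → y.1.1 = (t, i) →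
      (γ.partner x).1.1 = (t, i + 1) → (γ.partner y).1.1 = (t, i + 1) →
      (O.lt x y ↔ O.lt (γ.partner x) (γ.partner y)) := by
    intro i x y hx hy hpx hpy
    rw [hO x y (hx.trans hy.symm), hO _ _ (hpx.trans hpy.symm)]
    have hlx := (hc.le_iff hx).2 hpx
    have hly := (hc.le_iff hy).2 hpy
    rcases lt_trichotomy x.1.2 y.1.2 with hlt | he | hlt
    · exact (hc.height_lt_partner_iff h h1 h2 hπ hx hy hlx hlt).1
    · rw [show x = y from Subtype.ext (Prod.ext (hx.trans hy.symm) he)]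
      exact iff_of_false (lt_irrefl _) (lt_irrefl _)
    · exact (hc.height_lt_partner_iff h h1 h2 hπ hy hx hly hlt).2
  intro i j hij x y hx hy hpx hpy
  rcases fin3_cases hij.symm with rfl | rfl
  · exact key i x y hx hy hpx hpy
  · have := key (i + 2) (γ.partner x) (γ.partner y) hpx hpy
    simp only [γ.partner_partner, fin3_add_two_add_one] at this
    exact (this hx hy).symm

/-! ### Sanity -/

/-- At a 2-valent vertex and at a 3-valent vertex of type I, the edge of largest weight is outgoing,
and some incoming edge has half its weight. -/
lemma EdgeData.exists_flow {D : γ.EdgeData} (h2 : D.FlowAtTwoValent)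
    (h3I : D.FlowAtThreeValentTypeI) {v : γ.NarrowRegion}
    (hv : γ.valence v = 2 ∨ (γ.valence v = 3 ∧ γ.IsTypeI v)) :
    ∃ a ∈ γ.endsAt v, ∃ b ∈ γ.endsAt v, D.incoming a ∧ ¬ D.incoming b ∧
      D.weight b = 2 * D.weight a ∧ ∀ d ∈ γ.endsAt v, D.weight d ≤ D.weight b := by
  rcases hv with hv | ⟨hv, hI⟩
  · obtain ⟨a, b, m, hab, hia, hwa, hib, hwb⟩ := h2 v hv
    refine ⟨a, by simp [hab], b, by simp [hab], hia, hib, by rw [hwa, hwb, pow_succ'], ?_⟩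
    rw [hab, hwb]
    rintro d (rfl | rfl)
    · rw [hwa]
      exact pow_le_pow_right₀ one_le_two (by omega)
    · exact hwb.le
  · obtain ⟨a, b, d, m, r, hab, hia, hwa, hib, hwb, hwd, hr⟩ := h3I v hv hI
    refine ⟨a, by simp [hab], b, by simp [hab], hia, hib, by rw [hwa, hwb, pow_succ'], ?_⟩
    rw [hab, hwb]
    rintro d (rfl | rfl | rfl)
    · rw [hwa]
      exact pow_le_pow_right₀ one_le_two (by omega)
    · exact hwb.le
    · rw [hwd]
      exact pow_le_pow_right₀ one_le_two (by omega)

/-- The part `B` of a triangle between three loop segments, one at each corner, is a union of narrow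
regions with ends `B i` on side `i`. The dominant ends on the three sides are neither all incoming
nor all outgoing. -/
lemma EdgeData.not_all_dominant_iff [Finite Tri] {c : Tri → Fin 3 → ℕ} (hc : γ.IsCornerCount c)
    (h : γ.NoBacktrack) {D : γ.EdgeData} (h1 : D.DistinctDyadicWeights)
    (h2 : D.FlowAtTwoValent) (h3I : D.FlowAtThreeValentTypeI) (h3II : D.FlowAtThreeValentTypeII)
    (h4 : D.TypeIAboveTypeII) {t : Tri} {B : Fin 3 → Set γ.End}
    (hside : ∀ i, ∀ a ∈ B i, a.1.1 = (t, i)) (hne : (⋃ i, B i).Nonempty)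
    (hclosed : ∀ i, ∀ a ∈ B i, ∀ d, γ.vertexOf d = γ.vertexOf a → ∃ j, d ∈ B j)
    (hval : ∀ i, ∀ a ∈ B i, γ.valence (γ.vertexOf a) = 2 ∨ γ.valence (γ.vertexOf a) = 3)
    (hII : (∀ i, ∀ a ∈ B i, ¬ γ.IsTypeI (γ.vertexOf a)) → ∀ i, (B i).Subsingleton) (P : Prop) :
    ¬ ∀ i, ∀ a ∈ B i, (∀ b ∈ B i, D.weight b ≤ D.weight a) → (D.incoming a ↔ P) := by
  intro hdom
  obtain ⟨M, hM, hmax⟩ := D.exists_max hne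
  obtain ⟨i, hMi⟩ := Set.mem_iUnion.1 hM
  replace hmax : ∀ j, ∀ b ∈ B j, D.weight b ≤ D.weight M :=
    fun j b hb => hmax b (Set.mem_iUnion.2 ⟨j, hb⟩)
  by_cases hv : γ.valence (γ.vertexOf M) = 2 ∨
      (γ.valence (γ.vertexOf M) = 3 ∧ γ.IsTypeI (γ.vertexOf M))
  · obtain ⟨a, ha, b, hb, hia, hib, hw, hmaxb⟩ := D.exists_flow h2 h3I hv
    obtain ⟨j, haj⟩ := hclosed i M hMi a ha
    obtain ⟨l, hbl⟩ := hclosed i M hMi b hb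
    have hMw : D.weight M = D.weight b := le_antisymm (hmaxb M rfl) (hmax l b hbl)
    -- The end of largest weight is outgoing.
    obtain rfl : b = M := by
      rcases h1.2 b M hMw.symm with e | e
      · exact e.symm
      · exfalso
        -- Otherwise it would be the other half of the edge of `b`, and dominant along with `b`.
        have hiM : D.incoming M := by rw [e, D.incoming_flip]; exact hib
        have hP := (hdom i M hMi (hmax i)).1 hiM
        exact hib ((hdom l b hbl fun b' hb' => (hmax l b' hb').trans hMw.le).2 hP)
    have hP : ¬ P := fun hP => hib ((hdom i b hMi (hmax i)).2 hP)
    -- The dominant end on the side of `a` is outgoing, and has a weight strictly between those of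
    -- `a` and `b`.
    obtain ⟨d, hd, hdmax⟩ := D.exists_max ⟨a, haj⟩
    have hid : ¬ D.incoming d := fun hi => hP ((hdom j d hd hdmax).1 hi)
    have hlt : D.weight a < D.weight d := by
      refine lt_of_le_of_ne (hdmax a haj) fun e => ?_
      have := h1.eq_of_side_eq ((hside j a haj).trans (hside j d hd).symm) e
      exact hid (this ▸ hia)
    have hle := h1.two_mul_le hlt
    have hdb : d = b := h1.eq_of_incoming_iff (iff_of_false hid hib)
      (le_antisymm (hmax j d hd) (by linarith))
    have hab : a = b := hc.eq_of_vertexOf_eq h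
      ((hside j a haj).trans (hside j b (hdb ▸ hd)).symm) ha
    exact hib (hab ▸ hia)
  · push Not at hv
    have h3 := (hval i M hMi).resolve_left hv.1
    have hIIM := hv.2 h3
    have hall : ∀ j, ∀ a ∈ B j, ¬ γ.IsTypeI (γ.vertexOf a) := fun j a ha hI =>
      (h4 a M hI hIIM).not_ge (hmax j a ha)
    obtain ⟨⟨a, ha, hia⟩, b, hb, hib⟩ := h3II _ h3 hIIM
    obtain ⟨j, haj⟩ := hclosed i M hMi a ha
    obtain ⟨l, hbl⟩ := hclosed i M hMi b hb
    have hsub := hII hall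
    have hPa := (hdom j a haj fun b' hb' => (congrArg D.weight (hsub j hb' haj)).le).1 hia
    exact hib ((hdom l b hbl fun b' hb' => (congrArg D.weight (hsub l hb' hbl)).le).2 hPa)

lemma IsCornerCount.saneAt [Finite Tri] {c : Tri → Fin 3 → ℕ} (hc : γ.IsCornerCount c)
    (h : γ.NoBacktrack) {D : γ.EdgeData} (h1 : D.DistinctDyadicWeights)
    (h2 : D.FlowAtTwoValent) (h3I : D.FlowAtThreeValentTypeI) (h3II : D.FlowAtThreeValentTypeII)
    (h4 : D.TypeIAboveTypeII) {O : γ.ArcOrdering} (hO : D.transfer.Yields O) (t : Tri) :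
    O.SaneAt t := by
  obtain ⟨π, hπ, hO⟩ := hO
  rintro x ⟨hx, hins⟩
  -- `y i` and `x i` are the endpoints on side `i` of the segments at its first and its last corner.
  obtain ⟨y, hy⟩ : ∃ y : Fin 3 → Point γ.count, ∀ i, γ.partner (x i) = y (i + 1) :=
    ⟨fun i => γ.partner (x (i + 2)), fun i => by simp only [fin3_add_one_add_two]⟩
  have hys : ∀ i, (y i).1.1 = (t, i) := fun i => by
    have := (hx (i + 2)).2
    rwa [hy, fin3_add_two_add_one] at this
  have hxs : ∀ i, (x i).1.1 = (t, i) := fun i => (hx i).1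
  have hxy : ∀ i, (y i).1.1 = (x i).1.1 := fun i => (hys i).trans (hxs i).symm
  have hxle : ∀ i, c t (i + 2) ≤ (x i).1.2 := fun i => (hc.le_iff (hxs i)).2 (hx i).2
  have hxlt : ∀ i, (x i).1.2 < γ.count (t, i) := fun i => by
    have := (x i).2
    rwa [hxs] at this
  have hyx : ∀ i, (y (i + 1)).1.2 + (x i).1.2 + 1 = γ.count (t, i) := fun i => by
    rw [← hy, hc.partner_of_le t i (x i) (hxs i) (hxle i)]
    have := hxlt i
    simp only
    omega
  have hcount := hc.count_eq t
  have hylt : ∀ i, (y (i + 1)).1.2 < c t i := fun i => by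
    have := hcount i
    have := hyx i
    have := hxle i
    omega
  have hylt' : ∀ i, (y i).1.2 < c t (i + 2) := fun i => by
    have := hylt (i + 2)
    rwa [fin3_add_two_add_one] at this
  have hyltx : ∀ i, (y i).1.2 < (x i).1.2 := fun i => (hylt' i).trans_le (hxle i)
  have hyx' : ∀ i, (y i).1.2 + (x (i + 2)).1.2 + 1 = γ.count (t, i + 2) := fun i => by
    have := hyx (i + 2)
    rwa [fin3_add_two_add_one] at this
  have hcount1 : ∀ i, γ.count (t, i + 1) = c t i + c t (i + 1) := fun i => by
    rw [hcount, fin3_add_one_add_two]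
  have hcount2 : ∀ i, γ.count (t, i + 2) = c t (i + 1) + c t (i + 2) := fun i => by
    rw [hcount, fin3_add_two_add_two]
  have hside : ∀ i, ∀ a ∈ endsBetween (y i) (x i), a.1.1 = (t, i) := fun i a ha =>
    ha.1.trans (hys i)
  have hclosed : ∀ i, ∀ a ∈ endsBetween (y i) (x i), ∀ d, γ.vertexOf d = γ.vertexOf a →
      ∃ j, d ∈ endsBetween (y j) (x j) := by
    intro i a ha d hd
    obtain ⟨-, ha1, ha2⟩ := id ha
    rcases hc.end_cases h (hside i a ha) hd with rfl | ⟨hs, e1, e2⟩ | ⟨hs, e1, e2⟩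
    · exact ⟨i, ha⟩
    · have := hyx i
      have := hcount i
      have := hxle (i + 1)
      rw [fin3_add_one_add_two] at this
      exact ⟨i + 1, hs.trans (hys _).symm, by omega, by omega⟩
    · have := hylt' (i + 2)
      rw [fin3_add_two_add_two] at this
      have := hyx' i
      exact ⟨i + 2, hs.trans (hys _).symm, by omega, by omega⟩
  have hval : ∀ i, ∀ a ∈ endsBetween (y i) (x i),
      γ.valence (γ.vertexOf a) = 2 ∨ γ.valence (γ.vertexOf a) = 3 := by
    intro i a ha
    have has := hside i a ha
    have ha2 := a.2
    rw [has] at ha2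
    have := hcount i
    have := hcount1 i
    have := hcount2 i
    have hpos := hylt (i + 1)
    obtain ⟨d, hds, hd⟩ : ∃ d, d.1.1 ≠ a.1.1 ∧ γ.vertexOf d = γ.vertexOf a := by
      rcases le_or_gt (c t (i + 2)) a.1.2 with hle | hlt
      · obtain ⟨d, hds, hdk⟩ := exists_end (γ := γ) (s := (t, i + 1))
          (k := γ.count (t, i) - a.1.2) (by omega) (by omega)
        refine ⟨d, fun e => ?_, ((hc.vertexOf_eq_iff_of_next h has hds).2
          ⟨hle, by omega⟩).symm⟩
        rw [hds, has] at e
        have e' : i + 1 ≠ i := by clear * -; revert i; decide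
        exact e' (congrArg Prod.snd e)
      · obtain ⟨d, hds, hdk⟩ := exists_end (γ := γ) (s := (t, i + 2))
          (k := γ.count (t, i + 2) - a.1.2) (by omega) (by omega)
        refine ⟨d, fun e => ?_, (hc.vertexOf_eq_iff_of_next h hds
          (by rw [has, fin3_add_two_add_one])).2 ⟨?_, by omega⟩⟩
        · rw [hds, has] at e
          have e' : i + 2 ≠ i := by clear * -; revert i; decide
          exact e' (congrArg Prod.snd e)
        · rw [fin3_add_two_add_two]
          omega
    have h3 := hc.valence_le_three h (γ.vertexOf a)
    have h2 : 1 < γ.valence (γ.vertexOf a) :=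
      (Set.one_lt_ncard (hc.finite_endsAt h _)).2
        ⟨d, hd, a, rfl, fun e => hds (by rw [e])⟩
    omega
  -- If all narrow regions are of type II, there is no juncture between `y i` and `x i`.
  have hII : (∀ i, ∀ a ∈ endsBetween (y i) (x i), ¬ γ.IsTypeI (γ.vertexOf a)) →
      ∀ i, (endsBetween (y i) (x i)).Subsingleton := by
    intro hall i a ha b hb
    by_contra hne
    wlog hlt : a.1.2 < b.1.2 generalizing a b
    · exact this hb ha (Ne.symm hne) (lt_of_le_of_ne (not_lt.1 hlt) fun e =>
        hne (Subtype.ext (Prod.ext ((hside i a ha).trans (hside i b hb).symm) e.symm)))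
    have has := hside i a ha
    have hbs := hside i b hb
    have hb2 := b.2
    rw [hbs, ← has] at hb2
    obtain ⟨d, hds, hdk⟩ := exists_end (γ := γ) (s := a.1.1) (k := a.1.2 + 1)
      (by omega) (by omega)
    have hd : d ∈ endsBetween (y i) (x i) :=
      ⟨hds.trans ha.1, by have := ha.2.1; omega, by have := hb.2.2; omega⟩
    exact not_betweenTypeII hc h (γ.endPoint a)
      ⟨a, d, ⟨rfl, rfl, hall i a ha⟩, hds, hdk, hall i d hd⟩
  have hdom := fun P : Prop => EdgeData.not_all_dominant_iff hc h h1 h2 h3I h3II h4 hside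
    (let ⟨a, ha⟩ := endsBetween_nonempty (hxy 0) (hyltx 0); ⟨a, Set.mem_iUnion.2 ⟨0, ha⟩⟩)
    hclosed hval hII P
  have hlt_iff : ∀ i, (O.lt (γ.partner (x (i + 2))) (x (i + 2 + 1)) ↔ π (y i) < π (x i)) ∧
      (O.lt (x (i + 2 + 1)) (γ.partner (x (i + 2))) ↔ π (x i) < π (y i)) := fun i => by
    rw [hy, fin3_add_two_add_one]
    exact ⟨hO _ _ (hxy i), hO _ _ (hxy i).symm⟩
  rcases hins with hins | hins
  · refine hdom False fun i a ha hmax => ?_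
    have H := h1.height_lt hπ (hxy i) ha hmax
    exact iff_of_false (fun hi => (H.1 hi).not_gt ((hlt_iff i).1.1 (hins (i + 2)))) id
  · refine hdom True fun i a ha hmax => ?_
    have H := h1.height_lt hπ (hxy i) ha hmax
    exact iff_of_true (by_contra fun hi => (H.2 hi).not_gt ((hlt_iff i).2.1 (hins (i + 2))))
      trivial

end SimpleLoop
end IdealTriangulation

theorem mainTheorem6 {Tri : Type*} [Finite Tri] (T : IdealTriangulation Tri) (γ : T.SimpleLoop)
    (hcontr : ¬ γ.Contractible) (hperiph : ¬ γ.Peripheral) (hmin : γ.MinimalPosition)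
    (D : γ.EdgeData)
    (h1 : D.DistinctDyadicWeights)
    (h2 : D.FlowAtTwoValent)
    (h3I : D.FlowAtThreeValentTypeI)
    (h3II : D.FlowAtThreeValentTypeII)
    (h4 : D.TypeIAboveTypeII) :
    ∃ O : γ.ArcOrdering,
      (D.transfer.Yields O ∧ ∀ O' : γ.ArcOrdering, D.transfer.Yields O' → O' = O) ∧
      O.IsDyadic ∧
      ∀ t : Tri, O.CompatibleAt t ∧ O.SaneAt t := by
  have h : γ.NoBacktrack := hmin.partner_side_ne
  obtain ⟨c, hc⟩ := h.exists_isCornerCount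
  obtain ⟨O, hO, huniq⟩ := h1.exists_unique_yields
  exact ⟨O, ⟨hO, huniq⟩, ⟨D.transfer, h1.isDyadic_transfer, hO⟩, fun t =>
    ⟨hc.compatibleAt h h1 h2 hO t, hc.saneAt h h1 h2 h3I h3II h4 hO t⟩⟩
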